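/- Let $1\le d\le N$ be integers and let $$S^{N-1,d-1}_{\mathbb R}=\{x\in\mathbb R^N : \textstyle\sum_i x_i^2=1,\ x_{i_0}x_{i_1}\cdots x_{i_d}=0 \text{ for all distinct } i_0,\ldots,i_d\}.$$ A closed quantum subgroup $G\subset O_N^+$ is a compact matrix quantum group in the sense of Woronowicz whose fundamental matrix $u=(u_{ij})$ has self-adjoint entries and is orthogonal. That is, it is given by a nonzero unital $C^*$-algebra $C(G)$ and a matrix $u\in M_N(C(G))$ with $u_{ij}=u_{ij}^*$ and $uu^t=u^tu=1$, such that: the unital $*$-algebra $\mathcal A$ generated by the $u_{ij}$ is dense in $C(G)$; there is a unital $*$-homomorphism $\Delta:C(G)\to C(G)\otimes_{\min}C(G)$ with $\Delta(u_{ij})=\sum_k u_{ik}\otimes u_{kj}$; and there is a linear antimultiplicative map $\kappa:\mathcal A\to\mathcal A$ with $\kappa(\kappa(a^*)^*)=a$ for $a\in\mathcal A$ and $\sum_k\kappa(u_{ik})u_{kj}=\delta_{ij}=\sum_k u_{ik}\kappa(u_{kj})$. We write $H\subset G$ if there is a unital $*$-homomorphism $C(G)\to C(H)$ mapping the coordinates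 $u_{ij}$ of $G$ to those of $H$. For a compact set $X\subset\mathbb R^N$ with coordinate functions $x_1,\ldots,x_N\in C(X)$, we say that $G$ acts affinely on $X$ if there is a unital $*$-homomorphism $\Phi:C(X)\to C(G)\otimes C(X)$ with $\Phi(x_i)=\sum_j u_{ij}\otimes x_j$ for all $i$. The quantum isometry group $G^+(X)$ is the universal closed quantum subgroup of $O_N^+$ acting affinely on $X$: it acts affinely on $X$, and every closed quantum subgroup $H\subset O_N^+$ acting affinely on $X$ satisfies $H\subset G^+(X)$. Let $O_N$ be the orthogonal group and $H_N\subset O_N$ the hyperoctahedral group of signed permutation matrices, both viewed as closed quantum subgroups of $O_N^+$ through $C(O_N)$, $C(H_N)$ and the coordinate functions $U\mapsto U_{ij}$. Let $H_N^+$ be the free hyperoctahedral group: $C(H_N^+)$ is the universal unital $C^*$-algebra generated by the entries $u_{ij}=u_{ij}^*$ of an $N\times N$ matrix $u$ subject to $uu^t=u^tu=1$ and to $ab=0$ for any two distinct entries $a,b$ on the same row or the same column of $u$. Then the quantum isometry group of $S^{N-1,d-1}_{\mathbb R}$ is as follows: 1. if $d=1$, then $G^+(S^{N-1,d-1}_{\mathbb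 R})=H_N^+$; 2. if $2\le d\le N-1$, then $G^+(S^{N-1,d-1}_{\mathbb R})=H_N$; 3. if $d=N$, then $G^+(S^{N-1,d-1}_{\mathbb R})=O_N$. In particular, $H_N^+$, $H_N$ and $O_N$ are closed quantum subgroups of $O_N^+$ that act affinely on the respective spheres. -/

import Mathlib

open scoped TensorProduct

universe u v

noncomputable section

namespace PolygonalSphere

/-- A C⋆-seminorm on a complex unital ⋆-algebra. -/
structure CStarSeminorm (F : Type u) [Ring F] [StarRing F] [Algebra ℂ F] extends
    Seminorm ℂ F where
  mul_le' : ∀ x y, toFun (x * y) ≤ toFun x * toFun y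
  star_mul_self' : ∀ x, toFun (star x * x) = toFun x ^ 2

namespace CStarSeminorm

section Basic

variable {F : Type u} [Ring F] [StarRing F] [Algebra ℂ F]

instance : CoeFun (CStarSeminorm F) fun _ => F → ℝ := ⟨fun p => p.toSeminorm⟩

theorem mul_le (p : CStarSeminorm F) (x y : F) : p (x * y) ≤ p x * p y := p.mul_le' x y

theorem star_mul_self (p : CStarSeminorm F) (x : F) : p (star x * x) = p x ^ 2 :=
  p.star_mul_self' x

theorem nonneg (p : CStarSeminorm F) (x : F) : 0 ≤ p x := apply_nonneg p.toSeminorm x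

theorem le_star (p : CStarSeminorm F) (x : F) : p x ≤ p (star x) := by
  by_contra! h
  have h1 := p.mul_le (star x) x
  rw [p.star_mul_self] at h1
  have := p.nonneg (star x)
  nlinarith

theorem apply_star (p : CStarSeminorm F) (x : F) : p (star x) = p x :=
  le_antisymm (by simpa using p.le_star (star x)) (p.le_star x)

/-- The pointwise supremum of a pointwise bounded set of C⋆-seminorms. -/
def sup (P : Set (CStarSeminorm F)) (hP : ∀ x, BddAbove (Set.range fun p : P => p.1 x)) :
    CStarSeminorm F where
  toFun x := ⨆ p : P, p.1 x
  map_zero' := by simp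
  add_le' x y := Real.iSup_le (fun p => (map_add_le_add p.1.toSeminorm x y).trans
    (add_le_add (le_ciSup (hP x) p) (le_ciSup (hP y) p)))
    (add_nonneg (Real.iSup_nonneg fun p => p.1.nonneg x) (Real.iSup_nonneg fun p => p.1.nonneg y))
  neg' x := by simp
  smul' c x := by
    rw [Real.mul_iSup_of_nonneg (norm_nonneg c)]
    exact iSup_congr fun p => map_smul_eq_mul p.1.toSeminorm c x
  mul_le' x y := Real.iSup_le (fun p => (p.1.mul_le x y).trans
    (mul_le_mul (le_ciSup (hP x) p) (le_ciSup (hP y) p) (p.1.nonneg y)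
      (Real.iSup_nonneg fun p => p.1.nonneg x)))
    (mul_nonneg (Real.iSup_nonneg fun p => p.1.nonneg x) (Real.iSup_nonneg fun p => p.1.nonneg y))
  star_mul_self' x := by
    apply le_antisymm
    · refine Real.iSup_le (fun p => ?_) (sq_nonneg _)
      rw [p.1.star_mul_self]
      exact pow_le_pow_left₀ (p.1.nonneg x) (le_ciSup (hP x) p) 2
    · have h0 : 0 ≤ ⨆ p : P, p.1 (star x * x) := Real.iSup_nonneg fun p => p.1.nonneg _
      refine (Real.le_sqrt (Real.iSup_nonneg fun p => p.1.nonneg x) h0).1 ?_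
      refine Real.iSup_le (fun p => ?_) (Real.sqrt_nonneg _)
      refine (Real.le_sqrt (p.1.nonneg x) h0).2 ?_
      rw [← p.1.star_mul_self]
      exact le_ciSup (hP (star x * x)) p

/-- A copy of the ⋆-algebra `F`, topologised by the C⋆-seminorm `p`. -/
def Pre (_ : CStarSeminorm F) : Type u := F

variable (p : CStarSeminorm F)

/-- The identity map from `F` to its topologised copy. -/
def toPre (x : F) : p.Pre := x

instance : Ring p.Pre := inferInstanceAs (Ring F)
instance : StarRing p.Pre := inferInstanceAs (StarRing F)
instance : Algebra ℂ p.Pre := inferInstanceAs (Algebra ℂ F)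
instance [StarModule ℂ F] : StarModule ℂ p.Pre := inferInstanceAs (StarModule ℂ F)

instance : Norm p.Pre := ⟨fun x => p x⟩

instance : SeminormedRing p.Pre where
  toRing := inferInstance
  toNorm := inferInstance
  toPseudoMetricSpace :=
    (p.toSeminorm.toAddGroupSeminorm.toSeminormedAddCommGroup).toPseudoMetricSpace
  dist_eq _ _ := (p.toSeminorm.toAddGroupSeminorm.toSeminormedAddCommGroup).dist_eq _ _
  norm_mul_le := p.mul_le

instance : NormedAlgebra ℂ p.Pre where
  norm_smul_le c x := (map_smul_eq_mul p.toSeminorm c x).le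

instance : NormedStarGroup p.Pre where
  norm_star_le x := (p.apply_star x).le

/-- The (Hausdorff) completion of `F` with respect to the C⋆-seminorm `p`; a C⋆-algebra. -/
def Completion : Type u := UniformSpace.Completion p.Pre

instance : NormedRing p.Completion := inferInstanceAs (NormedRing (UniformSpace.Completion p.Pre))
instance : CompleteSpace p.Completion :=
  inferInstanceAs (CompleteSpace (UniformSpace.Completion p.Pre))
instance : Algebra ℂ p.Completion :=
  inferInstanceAs (Algebra ℂ (UniformSpace.Completion p.Pre))
instance : NormedAlgebra ℂ p.Completion where
  norm_smul_le c x := norm_smul_le (β := UniformSpace.Completion p.Pre) c x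

/-- The canonical map from `F` to its completion. -/
def of (x : F) : p.Completion := ((p.toPre x : p.Pre) : UniformSpace.Completion p.Pre)

theorem norm_of (x : F) : ‖p.of x‖ = p x := UniformSpace.Completion.norm_coe (p.toPre x)

theorem denseRange_of : DenseRange p.of :=
  UniformSpace.Completion.denseRange_coe (α := p.Pre)

theorem of_add (x y : F) : p.of (x + y) = p.of x + p.of y :=
  UniformSpace.Completion.coe_add (p.toPre x) (p.toPre y)

theorem of_mul (x y : F) : p.of (x * y) = p.of x * p.of y :=
  UniformSpace.Completion.coe_mul (p.toPre x) (p.toPre y)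

theorem of_one : p.of 1 = 1 := rfl

theorem of_smul (c : ℂ) (x : F) : p.of (c • x) = c • p.of x :=
  UniformSpace.Completion.coe_smul c (p.toPre x)

instance : Star p.Completion where
  star := UniformSpace.Completion.map (star : p.Pre → p.Pre)

theorem continuous_star : Continuous (star : p.Completion → p.Completion) :=
  UniformSpace.Completion.continuous_map

theorem of_star (x : F) : p.of (star x) = star (p.of x) :=
  (UniformSpace.Completion.map_coe (f := (star : p.Pre → p.Pre))
    star_isometry.uniformContinuous (p.toPre x)).symm

theorem induction {P : p.Completion → Prop} (hc : IsClosed {x | P x}) (h : ∀ x, P (p.of x)) :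
    ∀ x, P x := fun x => p.denseRange_of.induction_on x hc h

instance : StarRing p.Completion where
  star_involutive := p.induction
    (isClosed_eq (p.continuous_star.comp p.continuous_star) continuous_id) fun x => by
      simp [← of_star]
  star_mul x y := by
    have := p.continuous_star
    revert y
    refine p.induction (isClosed_eq (by fun_prop) (by fun_prop)) fun y => ?_
    revert x
    refine p.induction (isClosed_eq (by fun_prop) (by fun_prop)) fun x => ?_
    simp [← of_star, ← of_mul]
  star_add x y := by
    have := p.continuous_star
    revert y
    refine p.induction (isClosed_eq (by fun_prop) (by fun_prop)) fun y => ?_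
    revert x
    refine p.induction (isClosed_eq (by fun_prop) (by fun_prop)) fun x => ?_
    simp [← of_star, ← of_add]

instance [StarModule ℂ F] : CStarAlgebra p.Completion where
  norm_mul_self_le := p.induction
    (isClosed_le (by fun_prop) (continuous_norm.comp (p.continuous_star.mul continuous_id)))
    fun x => by
      rw [← of_star, ← of_mul, norm_of, norm_of, p.star_mul_self, sq]
  star_smul c := p.induction
    (isClosed_eq (p.continuous_star.comp (continuous_const_smul c))
      (continuous_const_smul (star c) |>.comp p.continuous_star)) fun x => by
      rw [← of_smul, ← of_star, ← of_star, star_smul, of_smul]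

/-- The canonical ⋆-homomorphism from `F` to its completion. -/
def ofHom : F →⋆ₐ[ℂ] p.Completion where
  toFun := p.of
  map_one' := p.of_one
  map_mul' := p.of_mul
  map_zero' := by simpa using p.of_smul 0 0
  map_add' := p.of_add
  commutes' c := by simp only [Algebra.algebraMap_eq_smul_one, of_smul, of_one]
  map_star' := p.of_star

end Basic

section Representation

variable {F : Type u} [Ring F] [StarRing F] [Algebra ℂ F]
  {V : Type v} [SeminormedAddCommGroup V] [InnerProductSpace ℂ V]

/-- The operator norm of a ⋆-representation of `F` by bounded operators on a (pre-)Hilbert space,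
as a C⋆-seminorm on `F`. -/
def ofRep (Θ : F →ₐ[ℂ] Module.End ℂ V)
    (hstar : ∀ t x y, inner ℂ (Θ t x) y = inner ℂ x (Θ (star t) y))
    (hbdd : ∀ t, ∃ C, ∀ x, ‖Θ t x‖ ≤ C * ‖x‖) : CStarSeminorm F where
  toFun t := ‖(Θ t).mkContinuousOfExistsBound (hbdd t)‖
  map_zero' := by
    refine le_antisymm (ContinuousLinearMap.opNorm_le_bound _ le_rfl fun x => ?_) (norm_nonneg _)
    simp
  add_le' s t := by
    refine ContinuousLinearMap.opNorm_le_bound _ (by positivity) fun x => ?_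
    have h1 := ((Θ s).mkContinuousOfExistsBound (hbdd s)).le_opNorm x
    have h2 := ((Θ t).mkContinuousOfExistsBound (hbdd t)).le_opNorm x
    simp only [LinearMap.mkContinuousOfExistsBound_apply, map_add, LinearMap.add_apply] at *
    exact (norm_add_le _ _).trans (by linarith)
  neg' t := by
    have : (Θ (-t)).mkContinuousOfExistsBound (hbdd (-t)) =
        -(Θ t).mkContinuousOfExistsBound (hbdd t) := by ext x; simp
    rw [this, norm_neg]
  smul' c t := by
    have : (Θ (c • t)).mkContinuousOfExistsBound (hbdd (c • t)) =
        c • (Θ t).mkContinuousOfExistsBound (hbdd t) := by ext x; simp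
    rw [this, norm_smul]
  mul_le' s t := by
    have : (Θ (s * t)).mkContinuousOfExistsBound (hbdd (s * t)) =
        (Θ s).mkContinuousOfExistsBound (hbdd s) ∘L
          (Θ t).mkContinuousOfExistsBound (hbdd t) := by ext x; simp
    rw [this]
    exact ContinuousLinearMap.opNorm_comp_le _ _
  star_mul_self' t := by
    have key : ∀ t, ‖(Θ t).mkContinuousOfExistsBound (hbdd t)‖ ^ 2 ≤
        ‖(Θ (star t * t)).mkContinuousOfExistsBound (hbdd (star t * t))‖ := fun t => by
      refine (Real.le_sqrt (norm_nonneg _) (norm_nonneg _)).1 ?_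
      refine ContinuousLinearMap.opNorm_le_bound _ (Real.sqrt_nonneg _) fun x => ?_
      rw [← Real.sqrt_sq (norm_nonneg x), ← Real.sqrt_mul (norm_nonneg _)]
      refine Real.le_sqrt_of_sq_le ?_
      simp only [LinearMap.mkContinuousOfExistsBound_apply]
      rw [← inner_self_eq_norm_sq (𝕜 := ℂ), hstar, ← Module.End.mul_apply, ← map_mul]
      have h1 := ((Θ (star t * t)).mkContinuousOfExistsBound (hbdd (star t * t))).le_opNorm x
      simp only [LinearMap.mkContinuousOfExistsBound_apply] at h1
      refine (re_inner_le_norm _ _).trans ?_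
      nlinarith [norm_nonneg x]
    have hmul : ∀ s t, ‖(Θ (s * t)).mkContinuousOfExistsBound (hbdd (s * t))‖ ≤
        ‖(Θ s).mkContinuousOfExistsBound (hbdd s)‖ *
          ‖(Θ t).mkContinuousOfExistsBound (hbdd t)‖ := fun s t => by
      have : (Θ (s * t)).mkContinuousOfExistsBound (hbdd (s * t)) =
          (Θ s).mkContinuousOfExistsBound (hbdd s) ∘L
            (Θ t).mkContinuousOfExistsBound (hbdd t) := by ext x; simp
      rw [this]
      exact ContinuousLinearMap.opNorm_comp_le _ _
    refine le_antisymm ?_ (key t)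
    have h1 := key (star t)
    rw [star_star] at h1
    have h2 := hmul (star t) t
    have h3 := hmul t (star t)
    set a := ‖(Θ t).mkContinuousOfExistsBound (hbdd t)‖
    set b := ‖(Θ (star t)).mkContinuousOfExistsBound (hbdd (star t))‖
    have hb : b ≤ a := by
      by_contra! h
      have : 0 ≤ a := norm_nonneg _
      nlinarith
    have : 0 ≤ a := norm_nonneg _
    nlinarith

theorem ofRep_apply_le {Θ : F →ₐ[ℂ] Module.End ℂ V}
    {hstar : ∀ t x y, inner ℂ (Θ t x) y = inner ℂ x (Θ (star t) y)}
    {hbdd : ∀ t, ∃ C, ∀ x, ‖Θ t x‖ ≤ C * ‖x‖} {t : F} {C : ℝ} (hC : 0 ≤ C)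
    (h : ∀ x, ‖Θ t x‖ ≤ C * ‖x‖) : ofRep Θ hstar hbdd t ≤ C :=
  ContinuousLinearMap.opNorm_le_bound _ hC h

end Representation

end CStarSeminorm

section Tensor

variable {A : Type u} {B : Type v} [CStarAlgebra A] [CStarAlgebra B]

/-- A ⋆-representation of a C⋆-algebra on a pre-Hilbert space is contractive. -/
theorem norm_rep_le {V : Type*} [SeminormedAddCommGroup V] [InnerProductSpace ℂ V]
    (Θ : A →ₐ[ℂ] Module.End ℂ V)
    (hstar : ∀ t x y, inner ℂ (Θ t x) y = inner ℂ x (Θ (star t) y)) (a : A) (x : V) :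
    ‖Θ a x‖ ≤ ‖a‖ * ‖x‖ := by
  let := CStarAlgebra.spectralOrder A
  let := CStarAlgebra.spectralOrderedRing A
  have h : (0 : A) ≤ algebraMap ℝ A (‖a‖ ^ 2) - star a * a :=
    sub_nonneg.2 CStarAlgebra.star_mul_le_algebraMap_norm_sq
  obtain ⟨r, hr⟩ := CStarAlgebra.nonneg_iff_eq_star_mul_self.1 h
  have e : star a * a = ((‖a‖ ^ 2 : ℝ) : ℂ) • (1 : A) - star r * r := by
    rw [← hr, Algebra.algebraMap_eq_smul_one, Complex.coe_smul]
    abel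
  have h1 : ∀ b : A, ‖Θ b x‖ ^ 2 = RCLike.re (inner ℂ x (Θ (star b * b) x)) := fun b => by
    rw [← inner_self_eq_norm_sq (𝕜 := ℂ), hstar, ← Module.End.mul_apply, ← map_mul]
  have h2 : ‖Θ a x‖ ^ 2 = ‖a‖ ^ 2 * ‖x‖ ^ 2 - ‖Θ r x‖ ^ 2 := by
    rw [h1 a, h1 r, e, ← inner_self_eq_norm_sq (𝕜 := ℂ) x, map_sub, map_smul, map_one,
      LinearMap.sub_apply, inner_sub_right, LinearMap.smul_apply, Module.End.one_apply,
      inner_smul_right, map_sub]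
    congr 1
    exact Complex.re_ofReal_mul _ _
  refine le_of_sq_le_sq ?_ (by positivity)
  nlinarith [sq_nonneg ‖Θ r x‖]

section Pair

variable {H : Type*} [NormedAddCommGroup H] [InnerProductSpace ℂ H] [CompleteSpace H]
  {K : Type*} [NormedAddCommGroup K] [InnerProductSpace ℂ K] [CompleteSpace K]

/-- A representation of `A` on `H`, with values regarded as linear maps. -/
def repEnd (π : A →⋆ₐ[ℂ] (H →L[ℂ] H)) : A →ₐ[ℂ] Module.End ℂ H :=
  AlgHom.ofLinearMap ((ContinuousLinearMap.coeLM ℂ).comp π.toAlgHom.toLinearMap)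
    (by ext x; simp) (fun a b => by ext x; simp)

/-- The representation `π ⊗ ρ` of `A ⊗ B` on the algebraic tensor product `H ⊗ K`,
so that `(a ⊗ b) (h ⊗ k) = π a h ⊗ ρ b k`. -/
def tensorRep (π : A →⋆ₐ[ℂ] (H →L[ℂ] H)) (ρ : B →⋆ₐ[ℂ] (K →L[ℂ] K)) :
    A ⊗[ℂ] B →ₐ[ℂ] Module.End ℂ (H ⊗[ℂ] K) :=
  (Module.endTensorEndAlgHom (R := ℂ) (S := ℂ) (A := ℂ) (M := H) (N := K)).comp
    (Algebra.TensorProduct.map (repEnd π) (repEnd ρ))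

theorem tensorRep_tmul (π : A →⋆ₐ[ℂ] (H →L[ℂ] H)) (ρ : B →⋆ₐ[ℂ] (K →L[ℂ] K)) (a : A) (b : B)
    (h : H) (k : K) : tensorRep π ρ (a ⊗ₜ b) (h ⊗ₜ k) = π a h ⊗ₜ ρ b k := rfl

theorem tensorRep_star (π : A →⋆ₐ[ℂ] (H →L[ℂ] H)) (ρ : B →⋆ₐ[ℂ] (K →L[ℂ] K)) (t : A ⊗[ℂ] B)
    (x y : H ⊗[ℂ] K) :
    inner ℂ (tensorRep π ρ t x) y = inner ℂ x (tensorRep π ρ (star t) y) := by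
  induction t using TensorProduct.induction_on with
  | zero => simp
  | add s t hs ht => simp only [map_add, LinearMap.add_apply, star_add, inner_add_left,
      inner_add_right, hs, ht]
  | tmul a b =>
    induction x using TensorProduct.induction_on with
    | zero => simp
    | add x x' hx hx' => simp only [map_add, inner_add_left, hx, hx']
    | tmul h k =>
      induction y using TensorProduct.induction_on with
      | zero => simp
      | add y y' hy hy' => simp only [map_add, inner_add_right, hy, hy']
      | tmul h' k' =>
        rw [TensorProduct.star_tmul, tensorRep_tmul, tensorRep_tmul, TensorProduct.inner_tmul,
          TensorProduct.inner_tmul, StarHomClass.map_star π, StarHomClass.map_star ρ,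
          ContinuousLinearMap.star_eq_adjoint,
          ContinuousLinearMap.star_eq_adjoint, ContinuousLinearMap.adjoint_inner_right,
          ContinuousLinearMap.adjoint_inner_right]

theorem norm_tensorRep_tmul_le (π : A →⋆ₐ[ℂ] (H →L[ℂ] H)) (ρ : B →⋆ₐ[ℂ] (K →L[ℂ] K))
    (a : A) (b : B) (x : H ⊗[ℂ] K) :
    ‖tensorRep π ρ (a ⊗ₜ b) x‖ ≤ ‖a‖ * ‖b‖ * ‖x‖ := by
  have h1 := norm_rep_le ((tensorRep π ρ).comp Algebra.TensorProduct.includeLeft)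
    (fun t x y => by simpa using tensorRep_star π ρ (t ⊗ₜ 1) x y) a (tensorRep π ρ (1 ⊗ₜ b) x)
  have h2 := norm_rep_le ((tensorRep π ρ).comp Algebra.TensorProduct.includeRight)
    (fun t x y => by simpa using tensorRep_star π ρ (1 ⊗ₜ t) x y) b x
  have e : tensorRep π ρ (a ⊗ₜ b) x = tensorRep π ρ (a ⊗ₜ 1) (tensorRep π ρ (1 ⊗ₜ b) x) := by
    rw [← Module.End.mul_apply, ← map_mul, Algebra.TensorProduct.tmul_mul_tmul, mul_one, one_mul]
  simp only [AlgHom.comp_apply, Algebra.TensorProduct.includeLeft_apply,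
    Algebra.TensorProduct.includeRight_apply] at h1 h2
  rw [e, mul_assoc]
  exact h1.trans (mul_le_mul_of_nonneg_left h2 (norm_nonneg a))

theorem exists_bound_tensorRep (t : A ⊗[ℂ] B) : ∃ C : ℝ, 0 ≤ C ∧
    ∀ (H : Type u) [NormedAddCommGroup H] [InnerProductSpace ℂ H] [CompleteSpace H]
      (K : Type v) [NormedAddCommGroup K] [InnerProductSpace ℂ K] [CompleteSpace K]
      (π : A →⋆ₐ[ℂ] (H →L[ℂ] H)) (ρ : B →⋆ₐ[ℂ] (K →L[ℂ] K)) (x : H ⊗[ℂ] K),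
      ‖tensorRep π ρ t x‖ ≤ C * ‖x‖ := by
  induction t using TensorProduct.induction_on with
  | zero => exact ⟨0, le_rfl, fun H _ _ _ K _ _ _ π ρ x => by simp⟩
  | tmul a b =>
    exact ⟨‖a‖ * ‖b‖, by positivity, fun H _ _ _ K _ _ _ π ρ x =>
      norm_tensorRep_tmul_le π ρ a b x⟩
  | add s t hs ht =>
    obtain ⟨C, hC, h⟩ := hs
    obtain ⟨D, hD, h'⟩ := ht
    refine ⟨C + D, by positivity, fun H _ _ _ K _ _ _ π ρ x => ?_⟩
    rw [map_add, LinearMap.add_apply, add_mul]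
    exact (norm_add_le _ _).trans (add_le_add (h H K π ρ x) (h' H K π ρ x))

end Pair

/-- The C⋆-seminorm `t ↦ ‖(π ⊗ ρ) t‖` on `A ⊗ B` for representations `π` and `ρ` on Hilbert
spaces (the operator norm on the dense subspace `H ⊗ K` of the Hilbert space tensor product). -/
def pairSeminorm {H : Type u} [NormedAddCommGroup H] [InnerProductSpace ℂ H] [CompleteSpace H]
    {K : Type v} [NormedAddCommGroup K] [InnerProductSpace ℂ K] [CompleteSpace K]
    (π : A →⋆ₐ[ℂ] (H →L[ℂ] H)) (ρ : B →⋆ₐ[ℂ] (K →L[ℂ] K)) : CStarSeminorm (A ⊗[ℂ] B) :=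
  CStarSeminorm.ofRep (tensorRep π ρ) (tensorRep_star π ρ) fun t =>
    let ⟨C, _, h⟩ := exists_bound_tensorRep t
    ⟨C, h H K π ρ⟩

variable (A B)

/-- All the C⋆-seminorms `‖(π ⊗ ρ) ·‖` on `A ⊗ B`. -/
def spatialFamily : Set (CStarSeminorm (A ⊗[ℂ] B)) :=
  {p | ∃ (H : Type u) (_ : NormedAddCommGroup H) (_ : InnerProductSpace ℂ H)
      (_ : CompleteSpace H) (K : Type v) (_ : NormedAddCommGroup K) (_ : InnerProductSpace ℂ K)
      (_ : CompleteSpace K) (π : A →⋆ₐ[ℂ] (H →L[ℂ] H)) (ρ : B →⋆ₐ[ℂ] (K →L[ℂ] K)),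
      p = pairSeminorm π ρ}

theorem bddAbove_spatialFamily (t : A ⊗[ℂ] B) :
    BddAbove (Set.range fun p : spatialFamily A B => p.1 t) := by
  obtain ⟨C, hC, h⟩ := exists_bound_tensorRep t
  refine ⟨C, ?_⟩
  rintro _ ⟨⟨p, H, _, _, _, K, _, _, _, π, ρ, rfl⟩, rfl⟩
  exact CStarSeminorm.ofRep_apply_le (hstar := tensorRep_star π ρ) hC (h H K π ρ)

/-- The spatial (minimal) C⋆-norm on the algebraic tensor product `A ⊗ B`:
`‖t‖ = sup ‖(π ⊗ ρ) t‖` over all representations `π` of `A` and `ρ` of `B`. -/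
def spatialNorm : CStarSeminorm (A ⊗[ℂ] B) :=
  CStarSeminorm.sup (spatialFamily A B) (bddAbove_spatialFamily A B)

/-- The spatial (minimal) tensor product of C⋆-algebras. -/
abbrev SpatialTensor : Type (max u v) := (spatialNorm A B).Completion

variable {A B}

/-- The elementary tensor `a ⊗ b` in the spatial tensor product. -/
def stmul (a : A) (b : B) : SpatialTensor A B := (spatialNorm A B).of (a ⊗ₜ b)

end Tensor

section Universal

/-- The free complex unital ⋆-algebra on self-adjoint generators indexed by `X`: the
complexification of the real free algebra, the involution being complex conjugation on scalars and
the reversal of words. -/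
abbrev FreeStarAlgebra (X : Type u) : Type u := ℂ ⊗[ℝ] FreeAlgebra ℝ X

variable {X : Type u}

instance : StarModule ℝ (FreeAlgebra ℝ X) where
  star_smul c x := by
    rw [Algebra.smul_def, star_mul, FreeAlgebra.star_algebraMap, star_trivial c,
      Algebra.smul_def, Algebra.commutes]

instance : StarModule ℂ (FreeStarAlgebra X) where
  star_smul c x := by
    induction x using TensorProduct.induction_on with
    | zero => simp
    | tmul z w => simp [TensorProduct.smul_tmul']
    | add x y hx hy => simp only [smul_add, star_add, hx, hy]

/-- The generators of the free ⋆-algebra. -/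
def gen (i : X) : FreeStarAlgebra X := 1 ⊗ₜ FreeAlgebra.ι ℝ i

theorem star_gen (i : X) : star (gen i) = gen i := by simp [gen]

/-- The C⋆-seminorms on the free ⋆-algebra for which the generators are contractions and the
elements of `R` vanish. -/
def relationFamily (R : Set (FreeStarAlgebra X)) : Set (CStarSeminorm (FreeStarAlgebra X)) :=
  {p | (∀ i, p (gen i) ≤ 1) ∧ ∀ r ∈ R, p r = 0}

theorem bddAbove_relationFamily (R : Set (FreeStarAlgebra X)) (t : FreeStarAlgebra X) :
    BddAbove (Set.range fun p : relationFamily R => p.1 t) := by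
  have hone : ∀ p : CStarSeminorm (FreeStarAlgebra X), p 1 ≤ 1 := fun p => by
    have h := p.star_mul_self 1
    rw [star_one, mul_one] at h
    nlinarith [p.nonneg 1]
  have key : ∀ w : FreeAlgebra ℝ X, ∃ C : ℝ, 0 ≤ C ∧ ∀ p : relationFamily R,
      p.1 ((1 : ℂ) ⊗ₜ[ℝ] w) ≤ C := fun w => by
    induction w using FreeAlgebra.induction with
    | grade0 r =>
      refine ⟨|r|, abs_nonneg r, fun p => ?_⟩
      have e : (1 : ℂ) ⊗ₜ[ℝ] algebraMap ℝ (FreeAlgebra ℝ X) r =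
          (r : ℂ) • (1 : FreeStarAlgebra X) := by
        rw [Algebra.algebraMap_eq_smul_one, TensorProduct.tmul_smul, Complex.coe_smul]
        rfl
      rw [e, map_smul_eq_mul p.1.toSeminorm, Complex.norm_real, Real.norm_eq_abs]
      exact mul_le_of_le_one_right (abs_nonneg r) (hone p.1)
    | grade1 x => exact ⟨1, zero_le_one, fun p => p.2.1 x⟩
    | mul a b ha hb =>
      obtain ⟨C, hC, h⟩ := ha
      obtain ⟨D, hD, h'⟩ := hb
      refine ⟨C * D, by positivity, fun p => ?_⟩
      have e : (1 : ℂ) ⊗ₜ[ℝ] (a * b) = ((1 : ℂ) ⊗ₜ[ℝ] a) * ((1 : ℂ) ⊗ₜ[ℝ] b) := by simp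
      rw [e]
      exact (p.1.mul_le _ _).trans (mul_le_mul (h p) (h' p) (p.1.nonneg _) hC)
    | add a b ha hb =>
      obtain ⟨C, hC, h⟩ := ha
      obtain ⟨D, hD, h'⟩ := hb
      refine ⟨C + D, by positivity, fun p => ?_⟩
      rw [TensorProduct.tmul_add]
      exact (map_add_le_add p.1.toSeminorm _ _).trans (add_le_add (h p) (h' p))
  suffices h : ∃ C : ℝ, ∀ p : relationFamily R, p.1 t ≤ C by
    obtain ⟨C, h⟩ := h
    exact ⟨C, by rintro _ ⟨p, rfl⟩; exact h p⟩
  induction t using TensorProduct.induction_on with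
  | zero => exact ⟨0, fun p => (map_zero p.1.toSeminorm).le⟩
  | tmul z w =>
    obtain ⟨C, hC, h⟩ := key w
    refine ⟨‖z‖ * C, fun p => ?_⟩
    have e : z ⊗ₜ[ℝ] w = z • ((1 : ℂ) ⊗ₜ[ℝ] w) := by simp [TensorProduct.smul_tmul']
    rw [e, map_smul_eq_mul p.1.toSeminorm]
    exact mul_le_mul_of_nonneg_left (h p) (norm_nonneg z)
  | add x y hx hy =>
    obtain ⟨C, h⟩ := hx
    obtain ⟨D, h'⟩ := hy
    exact ⟨C + D, fun p =>
      (map_add_le_add p.1.toSeminorm _ _).trans (add_le_add (h p) (h' p))⟩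

/-- The universal unital C⋆-algebra generated by self-adjoint contractions indexed by `X`, subject
to the relations `r = 0` for `r ∈ R`: the completion of the free ⋆-algebra in the largest
C⋆-seminorm compatible with the relations. -/
abbrev UniversalCStarAlgebra (R : Set (FreeStarAlgebra X)) : Type u :=
  (CStarSeminorm.sup (relationFamily R) (bddAbove_relationFamily R)).Completion

end Universal

section QuantumGroups

variable {N : ℕ}

/-- A unital C⋆-algebra with a distinguished `N × N` matrix of elements ("coordinates"). -/
structure CoordAlgebra (N : ℕ) where
  /-- The underlying C⋆-algebra, to be thought of as `C(G)`. -/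
  A : Type u
  [cstar : CStarAlgebra A]
  /-- The matrix of standard coordinates. -/
  u : Matrix (Fin N) (Fin N) A

attribute [instance] CoordAlgebra.cstar

namespace CoordAlgebra

/-- The ⋆-subalgebra generated by the coordinates. -/
def poly (G : CoordAlgebra.{u} N) : StarSubalgebra ℂ G.A :=
  StarAlgebra.adjoin ℂ {a | ∃ i j, a = G.u i j}

theorem u_mem_poly (G : CoordAlgebra.{u} N) (i j : Fin N) : G.u i j ∈ G.poly :=
  StarAlgebra.subset_adjoin ℂ _ ⟨i, j, rfl⟩

/-- The coordinates, as elements of the ⋆-subalgebra they generate. -/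
def polyU (G : CoordAlgebra.{u} N) (i j : Fin N) : G.poly := ⟨G.u i j, G.u_mem_poly i j⟩

/-- `(A, u)` is the algebra of continuous functions on a closed quantum subgroup `G ⊆ O_N⁺`:
a compact matrix quantum group in the sense of Woronowicz whose fundamental corepresentation `u`
has self-adjoint entries and is orthogonal. -/
structure IsQuantumSubgroup (G : CoordAlgebra.{u} N) : Prop where
  nontrivial : Nontrivial G.A
  selfAdjoint : ∀ i j, star (G.u i j) = G.u i j
  mul_transpose : G.u * G.u.transpose = 1
  transpose_mul : G.u.transpose * G.u = 1
  /-- The coordinates generate `A`. -/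
  dense : Dense (G.poly : Set G.A)
  /-- Comultiplication. -/
  comul : ∃ Δ : G.A →⋆ₐ[ℂ] SpatialTensor G.A G.A,
    ∀ i j, Δ (G.u i j) = ∑ k, stmul (G.u i k) (G.u k j)
  /-- Coinverse (antipode), on the dense ⋆-subalgebra of polynomial functions. -/
  coinverse : ∃ κ : G.poly →ₗ[ℂ] G.poly, (∀ a b, κ (a * b) = κ b * κ a) ∧
    (∀ a, κ (star (κ (star a))) = a) ∧
    (∀ i j, ∑ k, κ (G.polyU i k) * G.polyU k j = if i = j then 1 else 0) ∧
    ∀ i j, ∑ k, G.polyU i k * κ (G.polyU k j) = if i = j then 1 else 0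

/-- `H ⊆ G` as quantum subgroups of `O_N⁺`: the restriction map `C(G) → C(H)`, sending coordinates
to coordinates, is a (well-defined) ⋆-homomorphism. -/
def IsSubgroupOf (H : CoordAlgebra.{u} N) (G : CoordAlgebra.{v} N) : Prop :=
  ∃ f : G.A →⋆ₐ[ℂ] H.A, ∀ i j, f (G.u i j) = H.u i j

/-- The coordinate function `x_i` on `X ⊆ ℝᴺ`, as an element of `C(X)`. -/
def coordFun (X : Set (EuclideanSpace ℝ (Fin N))) (i : Fin N) : C(X, ℂ) :=
  ⟨fun p => (p.1 i : ℂ), by fun_prop⟩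

/-- The elementary tensor `a ⊗ f` in `A ⊗ C(X)`. The C⋆-algebra `A ⊗ C(X)` is `C(X, A)`, with
`a ⊗ f` being the function `p ↦ f(p) a`. -/
def funTensor {A : Type u} [CStarAlgebra A] {X : Type v} [TopologicalSpace X] (a : A)
    (f : C(X, ℂ)) : C(X, A) :=
  ⟨fun p => f p • a, by fun_prop⟩

/-- `G` acts affinely on the compact space `X ⊆ ℝᴺ`: there is a ⋆-homomorphism
`Φ : C(X) → C(G) ⊗ C(X)` with `Φ(x_i) = ∑ j, u_ij ⊗ x_j`. -/
def ActsAffinely (G : CoordAlgebra.{u} N) (X : Set (EuclideanSpace ℝ (Fin N)))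
    [CompactSpace X] : Prop :=
  ∃ Φ : C(X, ℂ) →⋆ₐ[ℂ] C(X, G.A),
    ∀ i, Φ (coordFun X i) = ∑ j, funTensor (G.u i j) (coordFun X j)

/-- `G` is the quantum isometry group of `X`: the universal object among the closed
quantum subgroups of `O_N⁺` acting affinely on `X`. -/
structure IsQuantumIsometryGroup (X : Set (EuclideanSpace ℝ (Fin N))) [CompactSpace X]
    (G : CoordAlgebra.{v} N) : Prop where
  isQuantumSubgroup : G.IsQuantumSubgroup
  actsAffinely : G.ActsAffinely X
  universal : ∀ H : CoordAlgebra.{u} N, H.IsQuantumSubgroup → H.ActsAffinely X →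
    H.IsSubgroupOf G

/-- The algebra `C(S)` of continuous functions on a compact set `S` of real matrices, with the
functions `U ↦ U i j` as coordinates. -/
def ofMatrices (S : Set (Matrix (Fin N) (Fin N) ℝ)) [CompactSpace S] : CoordAlgebra.{0} N where
  A := C(S, ℂ)
  u i j := ⟨fun U => (U.1 i j : ℂ),
    Complex.continuous_ofReal.comp (continuous_subtype_val.matrix_elem i j)⟩

end CoordAlgebra

variable (N)

/-- The orthogonal group `O_N`, as a set of matrices. -/
def orthogonalMatrices : Set (Matrix (Fin N) (Fin N) ℝ) := Matrix.orthogonalGroup (Fin N) ℝ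

/-- The hyperoctahedral group `H_N = ℤ₂ ≀ S_N`, as the set of signed permutation matrices. -/
def signedPermutations : Set (Matrix (Fin N) (Fin N) ℝ) :=
  Set.range fun e : Equiv.Perm (Fin N) × (Fin N → ℤˣ) =>
    Matrix.of fun i j => if j = e.1 i then ((e.2 i : ℤ) : ℝ) else 0

instance : CompactSpace (orthogonalMatrices N) := by
  rw [← isCompact_iff_compactSpace]
  have hc : IsCompact (Set.univ.pi fun _ : Fin N => Set.univ.pi fun _ : Fin N =>
      Set.Icc (-1 : ℝ) 1) :=
    isCompact_univ_pi fun _ => isCompact_univ_pi fun _ => isCompact_Icc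
  refine hc.of_isClosed_subset ?_ fun U hU i _ j _ => ?_
  · have : orthogonalMatrices N = {U | U * U.transpose = 1} := by
      ext U; exact Matrix.mem_orthogonalGroup_iff _ _
    rw [this]
    exact isClosed_eq (by fun_prop) continuous_const
  · have h : ∑ k, U i k * U i k = 1 :=
      (congrFun (congrFun ((Matrix.mem_orthogonalGroup_iff _ _).1 hU) i) i).trans
        (Matrix.one_apply_eq i)
    have h1 : U i j * U i j ≤ ∑ k, U i k * U i k :=
      Finset.single_le_sum (f := fun k => U i k * U i k) (fun k _ => mul_self_nonneg _)
        (Finset.mem_univ j)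
    have h2 : U i j * U i j ≤ 1 := h1.trans h.le
    exact abs_le.1 (abs_le_one_iff_mul_self_le_one.2 h2)

instance : CompactSpace (signedPermutations N) := by
  rw [← isCompact_iff_compactSpace]
  exact (Set.finite_range _).isCompact

/-- The coordinate algebra `C(O_N)` of the orthogonal group. -/
def orthogonalGroup : CoordAlgebra.{0} N := .ofMatrices (orthogonalMatrices N)

/-- The coordinate algebra `C(H_N)` of the hyperoctahedral group. -/
def hyperoctahedralGroup : CoordAlgebra.{0} N := .ofMatrices (signedPermutations N)

/-- The generators `u_ij` of the free ⋆-algebra on `N²` self-adjoint generators. -/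
def ugen {N : ℕ} (i j : Fin N) : FreeStarAlgebra (Fin N × Fin N) := gen (i, j)

/-- The relations `u uᵗ = uᵗ u = 1`, which define `O_N⁺`. -/
def orthogonalRelations : Set (FreeStarAlgebra (Fin N × Fin N)) :=
  {r | ∃ i j, r = ∑ k, ugen i k * ugen j k - if i = j then 1 else 0} ∪
    {r | ∃ i j, r = ∑ k, ugen k i * ugen k j - if i = j then 1 else 0}

/-- The relations `ab = 0` for distinct entries `a, b` of `u` on the same row or column. -/
def cubicRelations : Set (FreeStarAlgebra (Fin N × Fin N)) :=
  {r | ∃ i j k, j ≠ k ∧ r = ugen i j * ugen i k} ∪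
    {r | ∃ i j k, j ≠ k ∧ r = ugen j i * ugen k i}

/-- The free hyperoctahedral group `H_N⁺`: its algebra `C(H_N⁺)` is the universal C⋆-algebra
generated by the self-adjoint entries of an `N × N` orthogonal matrix, distinct entries on the same
row or column having product zero. (That the generators are contractions follows from
orthogonality, so imposing it is no restriction.) -/
def freeHyperoctahedralGroup : CoordAlgebra.{0} N where
  A := UniversalCStarAlgebra (orthogonalRelations N ∪ cubicRelations N)
  u i j := CStarSeminorm.of _ (ugen i j)

/-- The polygonal sphere `S^{N-1,d-1}`: the points `x` of the unit sphere of `ℝᴺ` such that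
`x_{i_0} ⋯ x_{i_d} = 0` for all distinct `i_0, …, i_d`. -/
def polygonalSphere (d : ℕ) : Set (EuclideanSpace ℝ (Fin N)) :=
  {x | x ∈ Metric.sphere 0 1 ∧ ∀ i : Fin (d + 1) ↪ Fin N, ∏ a, x (i a) = 0}

instance (d : ℕ) : CompactSpace (polygonalSphere N d) := by
  rw [← isCompact_iff_compactSpace]
  refine (isCompact_sphere (0 : EuclideanSpace ℝ (Fin N)) 1).inter_right ?_
  change IsClosed {x : EuclideanSpace ℝ (Fin N) | ∀ i : Fin (d + 1) ↪ Fin N, ∏ a, x (i a) = 0}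
  simp only [Set.ofPred_forall]
  exact isClosed_iInter fun i => isClosed_eq (by fun_prop) continuous_const

end QuantumGroups

end PolygonalSphere

end

/-! Evaluating an affine action on `X` at a point p of `X` gives a ⋆-homomorphism φ_p : C(X) → C(G)
with x_i ↦ ∑_j p_j u_ij (`ActsAffinely.exists_eval`). Every relation between the coordinates of `X`
thus becomes a relation between entries of u. The coinverse is antimultiplicative and sends u_ij to
u_ji (`exists_transpose`), so each such relation also holds in reversed and transposed form.

Case d = 1. At the vertex e_i, the relation x_j x_k = 0 becomes u_ji u_ki = 0, and the coinverse
turns this into the row relations (`IsQuantumSubgroup.isCubic`). Conversely, at p = ±e_j the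
elements w_i = ∑_j p_j u_ij have vanishing mutual products and satisfy ∑ w_i² = 1. Hence (w_i² ±
w_i)/2 is a partition of unity into projections indexed by the 2N vertices, and this defines φ_p.
The quantum group structure of H_N⁺ comes from its universal property.

Case d ≥ 2. Commutativity of C(X) at e_j makes entries of one column commute; at (3/5)e_j + (4/5)e_l
it then gives [u_ij, u_kl] = [u_kj, u_il]. The coinverse gives [u_ij, u_kl] = [u_il, u_kj]. The two
right-hand sides are opposite, so all commutators vanish (`u_comm`). Then C(G) is commutative, its
characters are real orthogonal matrices preserving `X`, and Gelfand duality embeds G in any compact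
set of matrices containing these (`isSubgroupOf_ofMatrices`). For d = N orthogonal matrices impose
no further condition. For d < N, counting squared entries over d columns shows that such a matrix is
a signed permutation (`mem_signedPermutations_of_preserves`). -/

noncomputable section

namespace PolygonalSphere

open CoordAlgebra

section

/-! ### Extending ⋆-homomorphisms to completions -/

namespace CStarSeminorm

variable {F : Type u} [Ring F] [StarRing F] [Algebra ℂ F]

theorem le_sup {P : Set (CStarSeminorm F)} (hP : ∀ x, BddAbove (Set.range fun p : P => p.1 x))
    {p : CStarSeminorm F} (hp : p ∈ P) (x : F) : p x ≤ sup P hP x :=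
  le_ciSup (hP x) ⟨p, hp⟩

/-- The C⋆-seminorm obtained by pulling back the norm along a ⋆-homomorphism. -/
def ofStarAlgHom {B : Type v} [CStarAlgebra B] (φ : F →⋆ₐ[ℂ] B) : CStarSeminorm F where
  toFun x := ‖φ x‖
  map_zero' := by simp
  add_le' x y := by simpa using norm_add_le (φ x) (φ y)
  neg' x := by simp
  smul' c x := by simp [norm_smul]
  mul_le' x y := by simpa using norm_mul_le (φ x) (φ y)
  star_mul_self' x := by
    simp only [map_mul, map_star, CStarRing.norm_star_mul_self, sq]

variable [StarModule ℂ F]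

/-- A ⋆-homomorphism bounded by a C⋆-seminorm extends to the completion. -/
theorem exists_extension (p : CStarSeminorm F) {B : Type v} [CStarAlgebra B]
    (φ : F →⋆ₐ[ℂ] B) (hφ : ∀ x, ‖φ x‖ ≤ p x) :
    ∃ f : p.Completion →⋆ₐ[ℂ] B, ∀ x, f (p.of x) = φ x := by
  -- On the copy topologised by `p`, the bound says that `φ` is 1-Lipschitz, so it extends
  -- continuously.
  let φ' : p.Pre → B := φ
  have huc : UniformContinuous φ' := by
    have : LipschitzWith 1 φ' := LipschitzWith.of_dist_le_mul fun x y => by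
      rw [dist_eq_norm, dist_eq_norm, NNReal.coe_one, one_mul]
      have : φ' x - φ' y = φ (x - y : F) := (map_sub φ (x : F) (y : F)).symm
      rw [this]
      exact hφ _
    exact this.uniformContinuous
  let f : p.Completion → B := UniformSpace.Completion.extension φ'
  have hf : Continuous f := UniformSpace.Completion.continuous_extension
  have hof : ∀ x, f (p.of x) = φ x := fun x => UniformSpace.Completion.extension_coe huc _
  have := p.continuous_star
  -- Each algebraic identity holds on the dense image of `F`; those with variables in the completion
  -- extend by continuity.
  refine ⟨⟨⟨⟨⟨⟨f, ?_⟩, ?_⟩, ?_, ?_⟩, ?_⟩, ?_⟩, hof⟩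
  · rw [← p.of_one, hof, map_one]
  · intro x y
    change f (x * y) = f x * f y
    revert y
    refine p.induction (isClosed_eq (by fun_prop) (by fun_prop)) fun y => ?_
    revert x
    refine p.induction (isClosed_eq (by fun_prop) (by fun_prop)) fun x => ?_
    rw [← of_mul, hof, hof, hof, map_mul]
  · change f 0 = 0
    rw [← map_zero p.ofHom]
    exact (hof 0).trans (map_zero φ)
  · intro x y
    change f (x + y) = f x + f y
    revert y
    refine p.induction (isClosed_eq (by fun_prop) (by fun_prop)) fun y => ?_
    revert x
    refine p.induction (isClosed_eq (by fun_prop) (by fun_prop)) fun x => ?_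
    rw [← of_add, hof, hof, hof, map_add]
  · intro c
    change f (algebraMap ℂ p.Completion c) = _
    rw [← AlgHomClass.commutes p.ofHom c]
    exact (hof _).trans (AlgHomClass.commutes φ c)
  · refine p.induction (isClosed_eq (by change Continuous fun x => f (star x); fun_prop)
      (by change Continuous fun x => star (f x); fun_prop)) fun x => ?_
    change f (star (p.of x)) = star (f (p.of x))
    rw [← of_star, hof, hof, map_star]

end CStarSeminorm

/-! ### Universal property of C⋆-algebras given by generators and relations -/

section Universal

variable {X : Type u} {B : Type v} [CStarAlgebra B]

/-- The algebra homomorphism from the free ⋆-algebra determined by the images of the generators. -/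
def freeLiftAlgHom (g : X → B) : FreeStarAlgebra X →ₐ[ℂ] B :=
  Algebra.TensorProduct.lift (Algebra.ofId ℂ B) (FreeAlgebra.lift ℝ g)
    fun z _ => by rw [Algebra.ofId_apply]; exact Algebra.commutes z _

theorem freeLiftAlgHom_tmul (g : X → B) (z : ℂ) (w : FreeAlgebra ℝ X) :
    freeLiftAlgHom g (z ⊗ₜ w) = z • FreeAlgebra.lift ℝ g w := by
  rw [freeLiftAlgHom, Algebra.TensorProduct.lift_tmul, Algebra.smul_def]
  rfl

/-- The ⋆-homomorphism from the free ⋆-algebra determined by self-adjoint elements. -/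
def freeLift (g : X → B) (hg : ∀ i, star (g i) = g i) : FreeStarAlgebra X →⋆ₐ[ℂ] B where
  toAlgHom := freeLiftAlgHom g
  map_star' t := by
    have key : ∀ w : FreeAlgebra ℝ X,
        FreeAlgebra.lift ℝ g (star w) = star (FreeAlgebra.lift ℝ g w) := fun w => by
      induction w using FreeAlgebra.induction with
      | grade0 r =>
        rw [FreeAlgebra.star_algebraMap, AlgHom.commutes, Algebra.algebraMap_eq_smul_one, star_smul,
          star_one, star_trivial]
      | grade1 x => simp [hg]
      | mul a b ha hb => simp [ha, hb]
      | add a b ha hb => simp [ha, hb]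
    change freeLiftAlgHom g (star t) = star (freeLiftAlgHom g t)
    induction t using TensorProduct.induction_on with
    | zero => simp
    | tmul z w => rw [TensorProduct.star_tmul, freeLiftAlgHom_tmul, freeLiftAlgHom_tmul, key,
        star_smul]
    | add x y hx hy => rw [star_add, map_add, map_add, star_add, hx, hy]

theorem freeLift_gen (g : X → B) (hg : ∀ i, star (g i) = g i) (i : X) :
    freeLift g hg (gen i) = g i := by
  refine (freeLiftAlgHom_tmul g 1 _).trans ?_
  rw [one_smul, FreeAlgebra.lift_ι_apply]

/-- Every seminorm of the family kills the relations, hence so does the supremum, and in the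
Hausdorff completion norm zero means zero. -/
theorem universal_of_eq_zero {R : Set (FreeStarAlgebra X)} {r : FreeStarAlgebra X} (hr : r ∈ R) :
    CStarSeminorm.ofHom (CStarSeminorm.sup (relationFamily R) (bddAbove_relationFamily R)) r =
      0 := by
  rw [← norm_eq_zero]
  refine (CStarSeminorm.norm_of _ r).trans ?_
  refine le_antisymm (Real.iSup_le (fun p => (p.2.2 r hr).le) le_rfl)
    (CStarSeminorm.nonneg _ _)

/-- The universal property of the universal C⋆-algebra with given relations. -/
theorem exists_universal_lift {R : Set (FreeStarAlgebra X)} (g : X → B)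
    (hg : ∀ i, star (g i) = g i) (hg1 : ∀ i, ‖g i‖ ≤ 1) (hR : ∀ r ∈ R, freeLift g hg r = 0) :
    ∃ f : UniversalCStarAlgebra R →⋆ₐ[ℂ] B, ∀ i, f (CStarSeminorm.of _ (gen i)) = g i := by
  obtain ⟨f, hf⟩ := CStarSeminorm.exists_extension
    (CStarSeminorm.sup (relationFamily R) (bddAbove_relationFamily R)) (freeLift g hg)
    -- The norm pulled back from `B` is itself a member of the family, so the supremum dominates it.
    fun x => CStarSeminorm.le_sup (bddAbove_relationFamily R)
      (p := CStarSeminorm.ofStarAlgHom (freeLift g hg)) ⟨fun i => by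
        change ‖freeLift g hg (gen i)‖ ≤ 1
        rw [freeLift_gen]; exact hg1 i, fun r hr => by
        change ‖freeLift g hg r‖ = 0
        rw [hR r hr, norm_zero]⟩ x
  exact ⟨f, fun i => (hf _).trans (freeLift_gen g hg i)⟩

/-- The free ⋆-algebra is generated by its generators. -/
theorem map_mem_of_gen_mem (φ : FreeStarAlgebra X →⋆ₐ[ℂ] B) (S : StarSubalgebra ℂ B)
    (h : ∀ i, φ (gen i) ∈ S) (t : FreeStarAlgebra X) : φ t ∈ S := by
  have key : ∀ w : FreeAlgebra ℝ X, φ (1 ⊗ₜ w) ∈ S := fun w => by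
    induction w using FreeAlgebra.induction with
    | grade0 r =>
      have e : (1 : ℂ) ⊗ₜ[ℝ] algebraMap ℝ (FreeAlgebra ℝ X) r =
          (r : ℂ) • (1 : FreeStarAlgebra X) := by
        rw [Algebra.algebraMap_eq_smul_one, TensorProduct.tmul_smul, Complex.coe_smul]
        rfl
      rw [e, map_smul, map_one]
      exact S.smul_mem (one_mem S) _
    | grade1 x => exact h x
    | mul a b ha hb =>
      have e : (1 : ℂ) ⊗ₜ[ℝ] (a * b) = ((1 : ℂ) ⊗ₜ[ℝ] a) * ((1 : ℂ) ⊗ₜ[ℝ] b) := by simp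
      rw [e, map_mul]
      exact mul_mem ha hb
    | add a b ha hb =>
      rw [TensorProduct.tmul_add, map_add]
      exact add_mem ha hb
  induction t using TensorProduct.induction_on with
  | zero => simp
  | tmul z w =>
    have e : z ⊗ₜ[ℝ] w = z • ((1 : ℂ) ⊗ₜ[ℝ] w) := by simp [TensorProduct.smul_tmul']
    rw [e, map_smul]
    exact S.smul_mem (key w) z
  | add x y hx hy =>
    rw [map_add]
    exact add_mem hx hy

end Universal

/-! ### Norm bound for orthogonal rows -/

section Norm

/-- Self-adjoint elements whose squares sum to one are contractions. -/
theorem norm_le_one_of_sum_mul_self {A : Type u} [CStarAlgebra A] {ι : Type*} [Fintype ι]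
    (a : ι → A) (ha : ∀ i, star (a i) = a i) (h : ∑ i, a i * a i = 1) (i : ι) : ‖a i‖ ≤ 1 := by
  let := CStarAlgebra.spectralOrder A
  let := CStarAlgebra.spectralOrderedRing A
  have h0 : ∀ j, 0 ≤ a j * a j := fun j => by
    simpa only [ha] using star_mul_self_nonneg (a j)
  have h1 : a i * a i ≤ 1 := h ▸ Finset.single_le_sum (fun j _ => h0 j) (Finset.mem_univ i)
  have h2 := CStarAlgebra.norm_le_norm_of_nonneg_of_le (h0 i) h1
  have h3 : ‖a i * a i‖ = ‖a i‖ * ‖a i‖ := by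
    simpa only [ha] using CStarRing.norm_star_mul_self (x := a i)
  -- Only an inequality is available, since `A` may be the zero algebra.
  have h4 : ‖(1 : A)‖ ≤ 1 := by
    have := CStarRing.norm_star_mul_self (x := (1 : A))
    rw [star_one, mul_one] at this
    nlinarith [norm_nonneg (1 : A)]
  nlinarith [norm_nonneg (a i)]

end Norm

/-! ### Calculus of elementary tensors -/

section Spatial

variable {A : Type u} {B : Type v} [CStarAlgebra A] [CStarAlgebra B]

theorem stmul_mul_stmul (a a' : A) (b b' : B) :
    stmul a b * stmul a' b' = stmul (a * a') (b * b') := by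
  simp only [stmul, ← CStarSeminorm.of_mul, Algebra.TensorProduct.tmul_mul_tmul]

theorem star_stmul (a : A) (b : B) : star (stmul a b) = stmul (star a) (star b) := by
  simp only [stmul, ← CStarSeminorm.of_star, TensorProduct.star_tmul]

theorem stmul_one_one : stmul (1 : A) (1 : B) = 1 := rfl

/-- `stmul` as a bilinear map. -/
def stmulₗ (A : Type u) (B : Type v) [CStarAlgebra A] [CStarAlgebra B] :
    A →ₗ[ℂ] B →ₗ[ℂ] SpatialTensor A B :=
  (TensorProduct.mk ℂ A B).compr₂ (CStarSeminorm.ofHom (spatialNorm A B)).toAlgHom.toLinearMap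

theorem stmul_zero (a : A) : stmul a (0 : B) = 0 := map_zero (stmulₗ A B a)

theorem zero_stmul (b : B) : stmul (0 : A) b = 0 := (stmulₗ A B).map_zero₂ b

theorem stmul_sum {ι : Type*} (s : Finset ι) (a : A) (b : ι → B) :
    stmul a (∑ i ∈ s, b i) = ∑ i ∈ s, stmul a (b i) := map_sum (stmulₗ A B a) b s

theorem sum_stmul {ι : Type*} (s : Finset ι) (a : ι → A) (b : B) :
    stmul (∑ i ∈ s, a i) b = ∑ i ∈ s, stmul (a i) b := (stmulₗ A B).map_sum₂ s a b

end Spatial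

end

/-! ### The free hyperoctahedral group as a compact quantum group -/

section

/-- An orthogonal matrix of self-adjoint elements such that distinct entries on the same row or
column have product zero. -/
structure IsCubic {N : ℕ} {B : Type v} [CStarAlgebra B] (v : Matrix (Fin N) (Fin N) B) :
    Prop where
  star_eq : ∀ i j, star (v i j) = v i j
  sum_row : ∀ i j, ∑ k, v i k * v j k = if i = j then 1 else 0
  sum_col : ∀ i j, ∑ k, v k i * v k j = if i = j then 1 else 0
  mul_row : ∀ i j k, j ≠ k → v i j * v i k = 0
  mul_col : ∀ i j k, j ≠ k → v j i * v k i = 0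

variable {N : ℕ} {B : Type v} [CStarAlgebra B]

/-- The universal algebra also requires contractive generators; here that comes for free, because
the squares along a row sum to 1. -/
theorem IsCubic.exists_lift {v : Matrix (Fin N) (Fin N) B} (hv : IsCubic v) :
    ∃ f : (freeHyperoctahedralGroup N).A →⋆ₐ[ℂ] B,
      ∀ i j, f ((freeHyperoctahedralGroup N).u i j) = v i j := by
  have hg : ∀ p : Fin N × Fin N, star (v p.1 p.2) = v p.1 p.2 := fun p => hv.star_eq _ _
  have hgen : ∀ i j, freeLift (fun p : Fin N × Fin N => v p.1 p.2) hg (ugen i j) = v i j :=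
    fun i j => freeLift_gen _ hg (i, j)
  obtain ⟨f, hf⟩ := exists_universal_lift (R := orthogonalRelations N ∪ cubicRelations N)
    (fun p => v p.1 p.2) hg
    (fun p => norm_le_one_of_sum_mul_self (fun k => v p.1 k) (hv.star_eq p.1)
      ((hv.sum_row p.1 p.1).trans (if_pos rfl)) p.2) (by
      rintro r ((⟨i, j, rfl⟩ | ⟨i, j, rfl⟩) | (⟨i, j, k, h, rfl⟩ | ⟨i, j, k, h, rfl⟩))
      · simp only [map_sub, map_sum, map_mul, hgen, hv.sum_row]
        split_ifs <;> simp
      · simp only [map_sub, map_sum, map_mul, hgen, hv.sum_col]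
        split_ifs <;> simp
      · rw [map_mul, hgen, hgen, hv.mul_row i j k h]
      · rw [map_mul, hgen, hgen, hv.mul_col i j k h])
  exact ⟨f, fun i j => hf (i, j)⟩

theorem isCubic_freeHyperoctahedralGroup (N : ℕ) : IsCubic (freeHyperoctahedralGroup N).u := by
  let φ := CStarSeminorm.ofHom (CStarSeminorm.sup
    (relationFamily (orthogonalRelations N ∪ cubicRelations N)) (bddAbove_relationFamily _))
  have hu : ∀ i j, (freeHyperoctahedralGroup N).u i j = φ (ugen i j) := fun _ _ => rfl
  have h0 : ∀ r ∈ orthogonalRelations N ∪ cubicRelations N, φ r = 0 := fun r hr =>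
    universal_of_eq_zero hr
  refine ⟨fun i j => ?_, fun i j => ?_, fun i j => ?_, fun i j k h => ?_, fun i j k h => ?_⟩
  · exact (map_star φ (ugen i j)).symm.trans (congrArg φ (star_gen (i, j)))
  · have := h0 _ (Or.inl (Or.inl ⟨i, j, rfl⟩))
    rw [map_sub, sub_eq_zero, map_sum] at this
    refine (Eq.trans ?_ this).trans ?_
    · exact Finset.sum_congr rfl fun k _ => (map_mul φ _ _).symm
    · split_ifs
      · exact map_one φ
      · exact map_zero φ
  · have := h0 _ (Or.inl (Or.inr ⟨i, j, rfl⟩))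
    rw [map_sub, sub_eq_zero, map_sum] at this
    refine (Eq.trans ?_ this).trans ?_
    · exact Finset.sum_congr rfl fun k _ => (map_mul φ _ _).symm
    · split_ifs
      · exact map_one φ
      · exact map_zero φ
  · exact (map_mul φ _ _).symm.trans (h0 _ (Or.inr (Or.inl ⟨i, j, k, h, rfl⟩)))
  · exact (map_mul φ _ _).symm.trans (h0 _ (Or.inr (Or.inr ⟨i, j, k, h, rfl⟩)))

/-- Lifted with values in `ℂ`, this matrix gives the counit, whose existence shows that the
universal algebra is not zero. -/
theorem isCubic_one : IsCubic (1 : Matrix (Fin N) (Fin N) B) where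
  star_eq i j := by rw [Matrix.one_apply]; split_ifs <;> simp
  sum_row i j := by simp [Matrix.one_apply]
  sum_col i j := by simp [Matrix.one_apply, eq_comm]
  mul_row i j k h := by
    simp only [Matrix.one_apply]; split_ifs <;> simp_all
  mul_col i j k h := by
    simp only [Matrix.one_apply]; split_ifs <;> simp_all

/-- The lift of this matrix is the comultiplication. Orthogonality collapses the sums one tensor leg
at a time; in the vanishing relations, a term is killed by one leg when the summation indices agree
and by the other when they differ. -/
theorem IsCubic.comul {v : Matrix (Fin N) (Fin N) B} (hv : IsCubic v) :
    IsCubic (Matrix.of fun i j => ∑ k, stmul (v i k) (v k j)) where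
  star_eq i j := by simp [star_sum, star_stmul, hv.star_eq]
  sum_row i j := by
    simp only [Matrix.of_apply, Finset.sum_mul_sum, stmul_mul_stmul]
    rw [Finset.sum_comm]
    have : ∀ k : Fin N, ∑ x, ∑ y, stmul (v i k * v j y) (v k x * v y x) =
        stmul (v i k * v j k) 1 := fun k => by
      rw [Finset.sum_comm]
      simp only [← stmul_sum, hv.sum_row]
      rw [Finset.sum_eq_single k (fun y _ hy => by rw [if_neg hy.symm, stmul_zero]) (by simp),
        if_pos rfl]
    simp only [this, ← sum_stmul, hv.sum_row]
    split_ifs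
    · exact stmul_one_one
    · exact zero_stmul _
  sum_col i j := by
    simp only [Matrix.of_apply, Finset.sum_mul_sum, stmul_mul_stmul]
    rw [Finset.sum_comm]
    have : ∀ k : Fin N, ∑ x, ∑ y, stmul (v x k * v x y) (v k i * v y j) =
        stmul 1 (v k i * v k j) := fun k => by
      rw [Finset.sum_comm]
      simp only [← sum_stmul, hv.sum_col]
      rw [Finset.sum_eq_single k (fun y _ hy => by rw [if_neg hy.symm, zero_stmul]) (by simp),
        if_pos rfl]
    simp only [this, ← stmul_sum, hv.sum_col]
    split_ifs
    · exact stmul_one_one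
    · exact stmul_zero _
  mul_row i j k h := by
    simp only [Matrix.of_apply, Finset.sum_mul_sum, stmul_mul_stmul]
    refine Finset.sum_eq_zero fun x _ => Finset.sum_eq_zero fun y _ => ?_
    rcases eq_or_ne x y with rfl | hxy
    · rw [hv.mul_row _ _ _ h, stmul_zero]
    · rw [hv.mul_row _ _ _ hxy, zero_stmul]
  mul_col i j k h := by
    simp only [Matrix.of_apply, Finset.sum_mul_sum, stmul_mul_stmul]
    refine Finset.sum_eq_zero fun x _ => Finset.sum_eq_zero fun y _ => ?_
    rcases eq_or_ne x y with rfl | hxy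
    · rw [hv.mul_col _ _ _ h, zero_stmul]
    · rw [hv.mul_col _ _ _ hxy, stmul_zero]

/-- Transposition exchanges the row and column relations. The lift, a homomorphism into the opposite
algebra, serves as the coinverse. -/
theorem IsCubic.op_transpose {v : Matrix (Fin N) (Fin N) B} (hv : IsCubic v) :
    IsCubic (Matrix.of fun i j => MulOpposite.op (v j i)) where
  star_eq i j := by simp [← MulOpposite.op_star, hv.star_eq]
  sum_row i j := by
    simp only [Matrix.of_apply, ← MulOpposite.op_mul, ← Finset.op_sum, hv.sum_col]
    split_ifs <;> simp_all
  sum_col i j := by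
    simp only [Matrix.of_apply, ← MulOpposite.op_mul, ← Finset.op_sum, hv.sum_row]
    split_ifs <;> simp_all
  mul_row i j k h := by
    simp only [Matrix.of_apply, ← MulOpposite.op_mul, hv.mul_col i k j h.symm, MulOpposite.op_zero]
  mul_col i j k h := by
    simp only [Matrix.of_apply, ← MulOpposite.op_mul, hv.mul_row i k j h.symm, MulOpposite.op_zero]

theorem dense_poly_freeHyperoctahedralGroup (N : ℕ) :
    Dense ((freeHyperoctahedralGroup N).poly : Set (freeHyperoctahedralGroup N).A) := by
  refine (CStarSeminorm.denseRange_of (CStarSeminorm.sup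
    (relationFamily (orthogonalRelations N ∪ cubicRelations N)) (bddAbove_relationFamily _))).mono ?_
  rintro _ ⟨t, rfl⟩
  exact map_mem_of_gen_mem (CStarSeminorm.ofHom _) (freeHyperoctahedralGroup N).poly
    (fun i => (freeHyperoctahedralGroup N).u_mem_poly i.1 i.2) t

/-- An antihomomorphism exchanging the coordinates with those of the transpose yields a
coinverse. -/
theorem CoordAlgebra.exists_coinverse (G : CoordAlgebra.{u} N)
    (h1 : G.u * G.u.transpose = 1) (h2 : G.u.transpose * G.u = 1)
    (f : G.A →⋆ₐ[ℂ] G.Aᵐᵒᵖ) (hf : ∀ i j, f (G.u i j) = MulOpposite.op (G.u j i)) :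
    ∃ κ : G.poly →ₗ[ℂ] G.poly, (∀ a b, κ (a * b) = κ b * κ a) ∧
      (∀ a, κ (star (κ (star a))) = a) ∧
      (∀ i j, ∑ k, κ (G.polyU i k) * G.polyU k j = if i = j then 1 else 0) ∧
      ∀ i j, ∑ k, G.polyU i k * κ (G.polyU k j) = if i = j then 1 else 0 := by
  have hmem : ∀ a ∈ G.poly, (f a).unop ∈ G.poly := fun a ha => by
    induction ha using StarAlgebra.adjoin_induction with
    | mem x hx =>
      obtain ⟨i, j, rfl⟩ := hx
      rw [hf]
      exact G.u_mem_poly j i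
    | algebraMap r =>
      rw [AlgHomClass.commutes]
      exact algebraMap_mem G.poly r
    | add x y _ _ hx hy => rw [map_add]; exact add_mem hx hy
    | mul x y _ _ hx hy => rw [map_mul]; exact mul_mem hy hx
    | star x _ hx => rw [map_star]; exact star_mem hx
  -- On polynomials `f` is involutive, because transposing twice is the identity. As `f` preserves
  -- ⋆, this gives κ(κ(a*)*) = a.
  have hinv : ∀ a ∈ G.poly, (f (f a).unop).unop = a := fun a ha => by
    induction ha using StarAlgebra.adjoin_induction with
    | mem x hx =>
      obtain ⟨i, j, rfl⟩ := hx
      rw [hf, MulOpposite.unop_op, hf, MulOpposite.unop_op]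
    | algebraMap r =>
      rw [AlgHomClass.commutes, MulOpposite.algebraMap_apply, MulOpposite.unop_op,
        AlgHomClass.commutes, MulOpposite.algebraMap_apply, MulOpposite.unop_op]
    | add x y _ _ hx hy => simp [hx, hy]
    | mul x y _ _ hx hy => simp [hx, hy]
    | star x _ hx => simp [map_star, hx]
  refine ⟨{ toFun := fun a => ⟨(f a).unop, hmem a a.2⟩
            map_add' := fun a b => Subtype.ext (by simp)
            map_smul' := fun c a => Subtype.ext (by simp) }, fun a b => ?_, fun a => ?_,
    fun i j => ?_, fun i j => ?_⟩
  · exact Subtype.ext (by simp)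
  · refine Subtype.ext ?_
    have := hinv a a.2
    simp [map_star, this]
  -- Since κ(u) is the transpose of u, the two coinverse identities are the orthogonality relations.
  · refine Subtype.ext ?_
    have := congrFun (congrFun h2 i) j
    simp only [Matrix.mul_apply, Matrix.transpose_apply, Matrix.one_apply] at this
    simp only [LinearMap.coe_mk, AddHom.coe_mk, polyU, hf, MulOpposite.unop_op,
      AddSubmonoidClass.coe_finsetSum, MulMemClass.mk_mul_mk, this]
    split_ifs <;> rfl
  · refine Subtype.ext ?_
    have := congrFun (congrFun h1 i) j
    simp only [Matrix.mul_apply, Matrix.transpose_apply, Matrix.one_apply] at this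
    simp only [LinearMap.coe_mk, AddHom.coe_mk, polyU, hf, MulOpposite.unop_op,
      AddSubmonoidClass.coe_finsetSum, MulMemClass.mk_mul_mk, this]
    split_ifs <;> rfl

theorem IsCubic.mul_transpose {v : Matrix (Fin N) (Fin N) B} (hv : IsCubic v) :
    v * v.transpose = 1 := by
  ext i j
  simp only [Matrix.mul_apply, Matrix.transpose_apply, hv.sum_row, Matrix.one_apply]

theorem IsCubic.transpose_mul {v : Matrix (Fin N) (Fin N) B} (hv : IsCubic v) :
    v.transpose * v = 1 := by
  ext i j
  simp only [Matrix.mul_apply, Matrix.transpose_apply, hv.sum_col, Matrix.one_apply]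

theorem isQuantumSubgroup_freeHyperoctahedralGroup (N : ℕ) :
    (freeHyperoctahedralGroup N).IsQuantumSubgroup := by
  have hu := isCubic_freeHyperoctahedralGroup N
  refine ⟨?_, hu.star_eq, hu.mul_transpose, hu.transpose_mul,
    dense_poly_freeHyperoctahedralGroup N, hu.comul.exists_lift, ?_⟩
  · obtain ⟨f, -⟩ := (isCubic_one (N := N) (B := ℂ)).exists_lift
    exact f.toAlgHom.toRingHom.domain_nontrivial
  · obtain ⟨f, hf⟩ := hu.op_transpose.exists_lift
    exact CoordAlgebra.exists_coinverse _ hu.mul_transpose hu.transpose_mul f hf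

end

section

variable {N : ℕ}

/-! ### Gelfand duality -/

section Gelfand

/-- The matrices attached to characters define a continuous map from the spectrum of `B` to `S`;
pulling functions back along it and inverting the Gelfand transform gives the homomorphism. -/
theorem exists_lift_ofMatrices_of_comm {B : Type v} [CommCStarAlgebra B]
    (S : Set (Matrix (Fin N) (Fin N) ℝ)) [CompactSpace S] (w : Matrix (Fin N) (Fin N) B)
    (hw : ∀ χ : B →ₐ[ℂ] ℂ, ∃ U ∈ S, ∀ i j, χ (w i j) = (U i j : ℂ)) :
    ∃ f : (ofMatrices S).A →⋆ₐ[ℂ] B, ∀ i j, f ((ofMatrices S).u i j) = w i j := by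
  choose U hU hUw using hw
  let θ : C(WeakDual.characterSpace ℂ B, S) :=
    ⟨fun χ => ⟨U (WeakDual.CharacterSpace.equivAlgHom χ), hU _⟩, by
      refine Continuous.subtype_mk (continuous_matrix fun i j => ?_) _
      -- The matrix is picked by choice, but its entries are determined by the Gelfand transforms of
      -- the `w i j`, which yields continuity.
      have e : (fun χ : WeakDual.characterSpace ℂ B =>
          U (WeakDual.CharacterSpace.equivAlgHom χ) i j) = fun χ => (χ (w i j)).re := by
        ext χ
        have := hUw (WeakDual.CharacterSpace.equivAlgHom χ) i j
        rw [WeakDual.CharacterSpace.equivAlgHom_coe] at this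
        rw [this, Complex.ofReal_re]
      rw [e]
      exact Complex.continuous_re.comp (gelfandStarTransform B (w i j)).continuous⟩
  refine ⟨StarAlgHom.comp
    ((gelfandStarTransform B).symm : C(WeakDual.characterSpace ℂ B, ℂ) →⋆ₐ[ℂ] B)
    (ContinuousMap.compStarAlgHom' ℂ ℂ θ), fun i j => ?_⟩
  refine (gelfandStarTransform B).injective
    (((gelfandStarTransform B).apply_symm_apply _).trans ?_)
  ext χ
  have := hUw (WeakDual.CharacterSpace.equivAlgHom χ) i j
  rw [WeakDual.CharacterSpace.equivAlgHom_coe] at this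
  exact this.symm

/-- A ⋆-homomorphism out of `C(S)` into a commutative C⋆-algebra is given by a matrix whose image
under every character lies in `S`. -/
theorem exists_lift_ofMatrices {B : Type v} [CStarAlgebra B] (hB : ∀ a b : B, a * b = b * a)
    (S : Set (Matrix (Fin N) (Fin N) ℝ)) [CompactSpace S] (w : Matrix (Fin N) (Fin N) B)
    (hw : ∀ χ : B →ₐ[ℂ] ℂ, ∃ U ∈ S, ∀ i j, χ (w i j) = (U i j : ℂ)) :
    ∃ f : (ofMatrices S).A →⋆ₐ[ℂ] B, ∀ i j, f ((ofMatrices S).u i j) = w i j := by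
  let : CommCStarAlgebra B := { ‹CStarAlgebra B› with mul_comm := hB }
  exact exists_lift_ofMatrices_of_comm S w hw

/-- Every character of `C(X)` is a point evaluation. -/
theorem exists_eq_eval {X : Type u} [TopologicalSpace X] [CompactSpace X] [T2Space X]
    (χ : C(X, ℂ) →ₐ[ℂ] ℂ) : ∃ x, ∀ f, χ f = f x := by
  obtain ⟨x, hx⟩ := (WeakDual.CharacterSpace.homeoEval X ℂ).surjective
    (WeakDual.CharacterSpace.equivAlgHom.symm χ)
  refine ⟨x, fun f => ?_⟩
  have := DFunLike.congr_fun hx f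
  rw [WeakDual.CharacterSpace.equivAlgHom_symm_coe] at this
  exact this.symm

/-- Characters of a C⋆-algebra are real on self-adjoint elements. -/
theorem exists_real_of_character {B : Type v} [CStarAlgebra B] (χ : B →ₐ[ℂ] ℂ) {b : B}
    (hb : star b = b) : ∃ r : ℝ, χ b = r := by
  have := AlgHomClass.instStarHomClass (F := B →ₐ[ℂ] ℂ) (A := B)
  have h : star (χ b) = χ b := by rw [← map_star, hb]
  exact ⟨(χ b).re, (Complex.conj_eq_iff_re.1 h).symm⟩

end Gelfand

/-! ### Compact matrix groups as quantum groups -/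

section OfMatrices

/-- This makes Gelfand duality applicable with the spatial tensor product as target; it suffices to
check elementary tensors. -/
theorem spatialTensor_comm {A : Type u} {B : Type v} [CommCStarAlgebra A] [CommCStarAlgebra B]
    (x y : SpatialTensor A B) : x * y = y * x := by
  revert y
  refine CStarSeminorm.induction _ (isClosed_eq (by fun_prop) (by fun_prop)) fun y => ?_
  revert x
  refine CStarSeminorm.induction _ (isClosed_eq (by fun_prop) (by fun_prop)) fun x => ?_
  rw [← CStarSeminorm.of_mul, ← CStarSeminorm.of_mul]
  congr 1
  induction x using TensorProduct.induction_on with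
  | zero => simp
  | add x x' hx hx' => rw [add_mul, mul_add, hx, hx']
  | tmul a b =>
    induction y using TensorProduct.induction_on with
    | zero => simp
    | add y y' hy hy' => rw [add_mul, mul_add, hy, hy']
    | tmul a' b' =>
      rw [Algebra.TensorProduct.tmul_mul_tmul, Algebra.TensorProduct.tmul_mul_tmul, mul_comm a,
        mul_comm b]

variable (S : Set (Matrix (Fin N) (Fin N) ℝ)) [CompactSpace S]

/-- A character of the tensor product restricts on the two legs to evaluations at some U and V in
`S`, hence sends ∑ u_ik ⊗ u_kj to the entries of UV. Identifying the tensor product with C(S × S) is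
thus unnecessary. -/
theorem exists_comul_ofMatrices (hmul : ∀ U ∈ S, ∀ V ∈ S, U * V ∈ S) :
    ∃ Δ : (ofMatrices S).A →⋆ₐ[ℂ] SpatialTensor (ofMatrices S).A (ofMatrices S).A,
      ∀ i j, Δ ((ofMatrices S).u i j) =
        ∑ k, stmul ((ofMatrices S).u i k) ((ofMatrices S).u k j) := by
  refine exists_lift_ofMatrices (fun a b => spatialTensor_comm (A := C(S, ℂ)) (B := C(S, ℂ)) a b) S
    (Matrix.of fun i j => ∑ k, stmul ((ofMatrices S).u i k) ((ofMatrices S).u k j)) fun χ => ?_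
  let ψ : C(S, ℂ) ⊗[ℂ] C(S, ℂ) →ₐ[ℂ] ℂ :=
    χ.comp (CStarSeminorm.ofHom (spatialNorm C(S, ℂ) C(S, ℂ))).toAlgHom
  obtain ⟨U, hU⟩ := exists_eq_eval (ψ.comp Algebra.TensorProduct.includeLeft)
  obtain ⟨V, hV⟩ := exists_eq_eval (ψ.comp Algebra.TensorProduct.includeRight)
  have key : ∀ a b : C(S, ℂ), χ (stmul a b) = a U * b V := fun a b => by
    have h : ψ (a ⊗ₜ b) = ψ (a ⊗ₜ 1) * ψ (1 ⊗ₜ b) := by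
      rw [← map_mul, Algebra.TensorProduct.tmul_mul_tmul, one_mul, mul_one]
    exact h.trans (congrArg₂ (· * ·) (hU a) (hV b))
  refine ⟨U.1 * V.1, hmul _ U.2 _ V.2, fun i j => ?_⟩
  rw [Matrix.of_apply, map_sum, Matrix.mul_apply, Complex.ofReal_sum]
  refine Finset.sum_congr rfl fun k _ => ?_
  rw [Complex.ofReal_mul]
  exact key _ _

/-- Stone–Weierstrass: matrix entries separate matrices. -/
theorem dense_poly_ofMatrices : Dense ((ofMatrices S).poly : Set (ofMatrices S).A) := by
  have h := ContinuousMap.starSubalgebra_topologicalClosure_eq_top_of_separatesPoints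
    (X := S) (𝕜 := ℂ) (ofMatrices S).poly ?_
  · intro x
    exact h.ge trivial
  · intro U V hUV
    obtain ⟨i, j, hij⟩ : ∃ i j, U.1 i j ≠ V.1 i j := by
      by_contra! h
      exact hUV (Subtype.ext (Matrix.ext h))
    exact ⟨_, ⟨(ofMatrices S).u i j, (ofMatrices S).u_mem_poly i j, rfl⟩,
      fun h => hij (Complex.ofReal_injective h)⟩

theorem isQuantumSubgroup_ofMatrices (hne : S.Nonempty) (hO : S ⊆ orthogonalMatrices N)
    (hmul : ∀ U ∈ S, ∀ V ∈ S, U * V ∈ S) (htr : ∀ U ∈ S, U.transpose ∈ S) :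
    (ofMatrices S).IsQuantumSubgroup := by
  have h1 : (ofMatrices S).u * (ofMatrices S).u.transpose = 1 := by
    ext i j
    refine ContinuousMap.ext fun U => ?_
    have := congrFun (congrFun ((Matrix.mem_orthogonalGroup_iff _ _).1 (hO U.2)) i) j
    rw [Matrix.mul_apply, Matrix.one_apply] at this
    rw [Matrix.mul_apply, Matrix.one_apply]
    refine (ContinuousMap.sum_apply _ _ U).trans ?_
    have h2 := congrArg (fun r : ℝ => (r : ℂ)) this
    simp only [Complex.ofReal_sum, Complex.ofReal_mul] at h2
    refine h2.trans ?_
    split_ifs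
    · exact Complex.ofReal_one
    · exact Complex.ofReal_zero
  have h2 : (ofMatrices S).u.transpose * (ofMatrices S).u = 1 := by
    ext i j
    refine ContinuousMap.ext fun U => ?_
    have := congrFun (congrFun ((Matrix.mem_orthogonalGroup_iff' _ _).1 (hO U.2)) i) j
    rw [Matrix.mul_apply, Matrix.one_apply] at this
    rw [Matrix.mul_apply, Matrix.one_apply]
    refine (ContinuousMap.sum_apply _ _ U).trans ?_
    have h2 := congrArg (fun r : ℝ => (r : ℂ)) this
    simp only [Complex.ofReal_sum, Complex.ofReal_mul] at h2
    refine h2.trans ?_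
    split_ifs
    · exact Complex.ofReal_one
    · exact Complex.ofReal_zero
  -- The coinverse is composition with transposition; it is also antimultiplicative because C(S) is
  -- commutative.
  let τ : C(S, S) := ⟨fun U => ⟨U.1.transpose, htr _ U.2⟩, by fun_prop⟩
  let f : C(S, ℂ) →⋆ₐ[ℂ] C(S, ℂ)ᵐᵒᵖ :=
    { toFun := fun g => MulOpposite.op (g.comp τ)
      map_one' := rfl
      map_mul' := fun a b => congrArg MulOpposite.op (mul_comm (a.comp τ) (b.comp τ))
      map_zero' := rfl
      map_add' := fun _ _ => rfl
      commutes' := fun _ => rfl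
      map_star' := fun _ => rfl }
  refine ⟨?_, fun i j => ?_, h1, h2, dense_poly_ofMatrices S, exists_comul_ofMatrices S hmul,
    exists_coinverse _ h1 h2 f fun _ _ => rfl⟩
  · have := hne.to_subtype
    exact inferInstanceAs (Nontrivial C(S, ℂ))
  · exact ContinuousMap.ext fun U => Complex.conj_ofReal _

/-- A compact set of matrices leaving `X` invariant acts affinely on `X`. -/
theorem actsAffinely_ofMatrices (X : Set (EuclideanSpace ℝ (Fin N))) [CompactSpace X]
    (h : ∀ U ∈ S, ∀ x ∈ X, WithLp.toLp 2 (U.mulVec x) ∈ X) : (ofMatrices S).ActsAffinely X := by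
  -- The action sends f to (x, U) ↦ f(Ux), curried into C(X, C(S)).
  let m : C(X × S, X) := ⟨fun p => ⟨WithLp.toLp 2 (p.2.1.mulVec p.1.1), h _ p.2.2 _ p.1.2⟩, by
    refine Continuous.subtype_mk ((PiLp.continuous_toLp 2 _).comp ?_) _
    exact Continuous.matrix_mulVec (by fun_prop) (by fun_prop)⟩
  let Φ : C(X, ℂ) →⋆ₐ[ℂ] C(X, C(S, ℂ)) :=
    { toFun := fun f => (f.comp m).curry
      map_one' := rfl
      map_mul' := fun _ _ => rfl
      map_zero' := rfl
      map_add' := fun _ _ => rfl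
      commutes' := fun _ => rfl
      map_star' := fun _ => rfl }
  refine ⟨Φ, fun i => ContinuousMap.ext fun x => ContinuousMap.ext fun U => ?_⟩
  have e : (∑ j, funTensor ((ofMatrices S).u i j) (coordFun X j)) x =
      ∑ j, funTensor ((ofMatrices S).u i j) (coordFun X j) x := ContinuousMap.sum_apply _ _ x
  rw [e]
  refine Eq.trans ?_ (ContinuousMap.sum_apply (α := S) (β := ℂ) _ _ U).symm
  change ((∑ j, U.1 i j * x.1 j : ℝ) : ℂ) = ∑ j, (x.1 j : ℂ) * (U.1 i j : ℂ)
  simp [mul_comm]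

end OfMatrices

end

section

/-! ### Orthogonal and signed permutation matrices -/

section Orthogonal

variable {N : ℕ}

theorem sum_row_of_mem_orthogonalMatrices {U : Matrix (Fin N) (Fin N) ℝ}
    (hU : U ∈ orthogonalMatrices N) (i j : Fin N) :
    ∑ k, U i k * U j k = if i = j then 1 else 0 :=
  (congrFun (congrFun ((Matrix.mem_orthogonalGroup_iff _ _).1 hU) i) j).trans Matrix.one_apply

theorem sum_col_of_mem_orthogonalMatrices {U : Matrix (Fin N) (Fin N) ℝ}
    (hU : U ∈ orthogonalMatrices N) (i j : Fin N) :
    ∑ k, U k i * U k j = if i = j then 1 else 0 :=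
  (congrFun (congrFun ((Matrix.mem_orthogonalGroup_iff' _ _).1 hU) i) j).trans Matrix.one_apply

theorem mul_mem_orthogonalMatrices {U V : Matrix (Fin N) (Fin N) ℝ}
    (hU : U ∈ orthogonalMatrices N) (hV : V ∈ orthogonalMatrices N) :
    U * V ∈ orthogonalMatrices N :=
  (Matrix.orthogonalGroup (Fin N) ℝ).mul_mem hU hV

theorem transpose_mem_orthogonalMatrices {U : Matrix (Fin N) (Fin N) ℝ}
    (hU : U ∈ orthogonalMatrices N) : U.transpose ∈ orthogonalMatrices N :=
  (Matrix.mem_orthogonalGroup_iff _ _).2 ((Matrix.mem_orthogonalGroup_iff' _ _).1 hU)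

theorem one_mem_orthogonalMatrices : (1 : Matrix (Fin N) (Fin N) ℝ) ∈ orthogonalMatrices N :=
  one_mem (Matrix.orthogonalGroup (Fin N) ℝ)

/-- Orthogonal matrices preserve the unit sphere. -/
theorem mulVec_mem_sphere {U : Matrix (Fin N) (Fin N) ℝ} (hU : U ∈ orthogonalMatrices N)
    {x : EuclideanSpace ℝ (Fin N)} (hx : x ∈ Metric.sphere 0 1) :
    WithLp.toLp 2 (U.mulVec x) ∈ Metric.sphere (0 : EuclideanSpace ℝ (Fin N)) 1 := by
  rw [mem_sphere_zero_iff_norm] at hx ⊢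
  rw [← sq_eq_sq₀ (norm_nonneg _) zero_le_one, EuclideanSpace.real_norm_sq_eq] at hx ⊢
  rw [← hx]
  have h : dotProduct (U.mulVec x) (U.mulVec x) = dotProduct x.ofLp x.ofLp := by
    rw [Matrix.dotProduct_mulVec, Matrix.vecMul_mulVec,
      show U.transpose * U = 1 from (Matrix.mem_orthogonalGroup_iff' _ _).1 hU,
      Matrix.vecMul_one]
  simpa only [dotProduct, sq] using h

theorem signedPermutations_subset : signedPermutations N ⊆ orthogonalMatrices N := by
  rintro _ ⟨⟨σ, ε⟩, rfl⟩
  refine (Matrix.mem_orthogonalGroup_iff _ _).2 ?_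
  ext i j
  simp only [Matrix.mul_apply, Matrix.of_apply, Matrix.one_apply,
    ite_mul, zero_mul, Finset.sum_ite_eq', Finset.mem_univ, if_true]
  split_ifs with h
  · subst h
    rcases Int.units_eq_one_or (ε i) with h | h <;> simp [h]
  · simpa using h

theorem mul_row_of_mem_signedPermutations {U : Matrix (Fin N) (Fin N) ℝ}
    (hU : U ∈ signedPermutations N) {i j k : Fin N} (h : j ≠ k) : U i j * U i k = 0 := by
  obtain ⟨⟨σ, ε⟩, rfl⟩ := hU
  simp only [Matrix.of_apply]
  split_ifs <;> simp_all

theorem mul_col_of_mem_signedPermutations {U : Matrix (Fin N) (Fin N) ℝ}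
    (hU : U ∈ signedPermutations N) {i j k : Fin N} (h : j ≠ k) : U j i * U k i = 0 := by
  obtain ⟨⟨σ, ε⟩, rfl⟩ := hU
  simp only [Matrix.of_apply]
  split_ifs with h1 h2
  · exact absurd (σ.injective (h1.symm.trans h2)) h
  all_goals simp

/-- An orthogonal matrix with at most one nonzero entry on each row is a signed permutation. -/
theorem mem_signedPermutations {U : Matrix (Fin N) (Fin N) ℝ} (hU : U ∈ orthogonalMatrices N)
    (h : ∀ i j k, j ≠ k → U i j * U i k = 0) : U ∈ signedPermutations N := by
  have h1 : ∀ i, ∃ j, U i j ≠ 0 := fun i => by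
    by_contra! h0
    simpa [h0] using sum_row_of_mem_orthogonalMatrices hU i i
  choose σ hσ using h1
  have h2 : ∀ i j, j ≠ σ i → U i j = 0 := fun i j hj =>
    (mul_eq_zero.1 (h i j (σ i) hj)).resolve_right (hσ i)
  have h3 : ∀ i, U i (σ i) = 1 ∨ U i (σ i) = -1 := fun i => by
    have := sum_row_of_mem_orthogonalMatrices hU i i
    rw [Finset.sum_eq_single (σ i) (fun j _ hj => by rw [h2 i j hj, zero_mul]) (by simp),
      if_pos rfl] at this
    exact mul_self_eq_one_iff.1 this
  have h4 : ∀ i, ∃ ε : ℤˣ, U i (σ i) = ((ε : ℤ) : ℝ) := fun i => by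
    rcases h3 i with h | h
    · exact ⟨1, by simpa using h⟩
    · exact ⟨-1, by simpa using h⟩
  choose ε hε using h4
  -- If two rows had their nonzero entries in the same column, their inner product would be a single
  -- nonzero term.
  have hinj : Function.Injective σ := fun i j hij => by
    by_contra hne
    have := sum_row_of_mem_orthogonalMatrices hU i j
    rw [if_neg hne, Finset.sum_eq_single (σ i) (fun k _ hk => by rw [h2 i k hk, zero_mul])
      (by simp)] at this
    rcases mul_eq_zero.1 this with h | h
    · exact hσ i h
    · exact hσ j (hij ▸ h)
  refine ⟨(Equiv.ofBijective σ (Finite.injective_iff_bijective.1 hinj), ε), ?_⟩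
  ext i j
  simp only [Matrix.of_apply, Equiv.ofBijective_apply]
  split_ifs with hj
  · rw [hj, hε]
  · rw [h2 i j hj]

theorem mul_mem_signedPermutations {U V : Matrix (Fin N) (Fin N) ℝ}
    (hU : U ∈ signedPermutations N) (hV : V ∈ signedPermutations N) :
    U * V ∈ signedPermutations N := by
  refine mem_signedPermutations (mul_mem_orthogonalMatrices (signedPermutations_subset hU)
    (signedPermutations_subset hV)) fun i j k h => ?_
  rw [Matrix.mul_apply, Matrix.mul_apply, Finset.sum_mul_sum]
  refine Finset.sum_eq_zero fun x _ => Finset.sum_eq_zero fun y _ => ?_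
  rcases eq_or_ne x y with rfl | hxy
  · rw [mul_mul_mul_comm, mul_row_of_mem_signedPermutations hV h, mul_zero]
  · rw [mul_mul_mul_comm, mul_row_of_mem_signedPermutations hU hxy, zero_mul]

theorem transpose_mem_signedPermutations {U : Matrix (Fin N) (Fin N) ℝ}
    (hU : U ∈ signedPermutations N) : U.transpose ∈ signedPermutations N :=
  mem_signedPermutations (transpose_mem_orthogonalMatrices (signedPermutations_subset hU))
    fun _ _ _ h => mul_col_of_mem_signedPermutations hU h

theorem one_mem_signedPermutations :
    (1 : Matrix (Fin N) (Fin N) ℝ) ∈ signedPermutations N :=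
  mem_signedPermutations one_mem_orthogonalMatrices fun i j k h => by
    simp only [Matrix.one_apply]
    split_ifs <;> simp_all

end Orthogonal

/-! ### Polygonal spheres and the matrices preserving them -/

section Sphere

variable {N d : ℕ}

/-- A point of the unit sphere lies on the polygonal sphere iff it has at most `d` nonzero
coordinates. -/
theorem mem_polygonalSphere_iff {x : EuclideanSpace ℝ (Fin N)} :
    x ∈ polygonalSphere N d ↔ ‖x‖ = 1 ∧ (Finset.univ.filter fun i => x i ≠ 0).card ≤ d := by
  rw [← mem_sphere_zero_iff_norm]
  refine and_congr_right fun _ => ⟨fun h => ?_, fun h i => ?_⟩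
  · by_contra! hc
    refine Finset.prod_ne_zero_iff.2 (fun a _ => ?_)
      (h (Finset.orderEmbOfCardLe _ (Nat.succ_le_of_lt hc)).toEmbedding)
    exact (Finset.mem_filter.1 (Finset.orderEmbOfCardLe_mem _ (Nat.succ_le_of_lt hc) a)).2
  · by_contra hne
    rw [← ne_eq, Finset.prod_ne_zero_iff] at hne
    have h1 : (Finset.univ.map i) ⊆ Finset.univ.filter fun i => x i ≠ 0 := fun b hb => by
      obtain ⟨a, -, rfl⟩ := Finset.mem_map.1 hb
      exact Finset.mem_filter.2 ⟨Finset.mem_univ _, hne a (Finset.mem_univ a)⟩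
    have h2 := Finset.card_le_card h1
    rw [Finset.card_map, Finset.card_univ, Fintype.card_fin] at h2
    omega

/-- There are no N + 1 distinct indices, so the product condition is vacuous and only the norm
matters. -/
theorem mulVec_mem_polygonalSphere_self {U : Matrix (Fin N) (Fin N) ℝ}
    (hU : U ∈ orthogonalMatrices N) {x : EuclideanSpace ℝ (Fin N)}
    (hx : x ∈ polygonalSphere N N) : WithLp.toLp 2 (U.mulVec x) ∈ polygonalSphere N N :=
  ⟨mulVec_mem_sphere hU hx.1, fun i => absurd (Fintype.card_le_of_embedding i) (by simp)⟩

theorem mulVec_mem_polygonalSphere {U : Matrix (Fin N) (Fin N) ℝ}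
    (hU : U ∈ signedPermutations N) {x : EuclideanSpace ℝ (Fin N)}
    (hx : x ∈ polygonalSphere N d) : WithLp.toLp 2 (U.mulVec x) ∈ polygonalSphere N d := by
  refine ⟨mulVec_mem_sphere (signedPermutations_subset hU) hx.1, fun i => ?_⟩
  obtain ⟨⟨σ, ε⟩, rfl⟩ := hU
  have h : ∀ k, (Matrix.of fun i j => if j = σ i then ((ε i : ℤ) : ℝ) else 0).mulVec
      x.ofLp k = ((ε k : ℤ) : ℝ) * x (σ k) := fun k => by
    simp [Matrix.mulVec, dotProduct]
  simp only [h, Finset.prod_mul_distrib]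
  rw [show ∏ a, x (σ (i a)) = 0 from hx.2 (i.trans σ.toEmbedding), mul_zero]

theorem single_mem_polygonalSphere (hd : 1 ≤ d) (j : Fin N) {ε : ℝ} (hε : |ε| = 1) :
    EuclideanSpace.single j ε ∈ polygonalSphere N d := by
  refine mem_polygonalSphere_iff.2 ⟨by simpa using hε, le_trans ?_ hd⟩
  refine (Finset.card_le_card (t := {j}) fun i hi => ?_).trans (Finset.card_singleton j).le
  by_contra hne
  simp_all

/-- A rational point of the unit circle with both coordinates nonzero; this makes the cross terms
visible in `u_comm`. -/
theorem add_single_mem_polygonalSphere (hd : 2 ≤ d) {j l : Fin N} (hjl : j ≠ l) :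
    EuclideanSpace.single j (3 / 5 : ℝ) + EuclideanSpace.single l (4 / 5 : ℝ) ∈
      polygonalSphere N d := by
  refine mem_polygonalSphere_iff.2 ⟨?_, le_trans ?_ hd⟩
  · rw [← sq_eq_sq₀ (norm_nonneg _) zero_le_one, EuclideanSpace.real_norm_sq_eq,
      Finset.sum_eq_add j l hjl (fun i _ hi => by simp [hi.1, hi.2]) (by simp) (by simp)]
    simp [hjl, hjl.symm]
    norm_num
  · refine (Finset.card_le_card (t := {j, l}) fun i hi => ?_).trans Finset.card_le_two
    by_contra hne
    simp_all

/-- The points of `S^{N-1,0}` are the standard basis vectors and their negatives. -/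
theorem exists_eq_single_of_mem {x : EuclideanSpace ℝ (Fin N)} (hx : x ∈ polygonalSphere N 1) :
    ∃ (j : Fin N) (ε : ℤˣ), x = EuclideanSpace.single j ((ε : ℤ) : ℝ) := by
  obtain ⟨h1, h2⟩ := mem_polygonalSphere_iff.1 hx
  obtain ⟨j, hj⟩ : ∃ j, x j ≠ 0 := by
    by_contra! h
    have : x = 0 := by ext i; exact h i
    simp [this] at h1
  have h0 : ∀ i, i ≠ j → x i = 0 := fun i hi => by
    by_contra hne
    exact hi (Finset.card_le_one.1 h2 i (by simpa using hne) j (by simpa using hj))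
  have e : x = EuclideanSpace.single j (x j) := by
    ext i
    rcases eq_or_ne i j with rfl | h
    · simp
    · simp [h, h0 i h]
  rw [e, PiLp.norm_single, Real.norm_eq_abs] at h1
  rcases eq_or_eq_neg_of_abs_eq h1 with h | h
  · exact ⟨j, 1, by rw [e, h]; simp⟩
  · exact ⟨j, -1, by rw [e, h]; simp⟩

open Classical in
/-- The rows in which some column belonging to `A` is nonzero. -/
def rowSupport (U : Matrix (Fin N) (Fin N) ℝ) (A : Finset (Fin N)) : Finset (Fin N) :=
  Finset.univ.filter fun i => ∃ j ∈ A, U i j ≠ 0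

theorem mem_rowSupport {U : Matrix (Fin N) (Fin N) ℝ} {A : Finset (Fin N)} {i : Fin N} :
    i ∈ rowSupport U A ↔ ∃ j ∈ A, U i j ≠ 0 := by
  simp [rowSupport]

/-- A generic vector supported on `A` is annihilated by no row of `rowSupport U A`: finitely many
nonzero functionals on a real vector space have a common point of non-vanishing. Once normalised, it
lies on the sphere, and its image is nonzero in all these rows. -/
theorem card_rowSupport_le {U : Matrix (Fin N) (Fin N) ℝ}
    (hU : ∀ x ∈ polygonalSphere N d, WithLp.toLp 2 (U.mulVec x) ∈ polygonalSphere N d)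
    {A : Finset (Fin N)} (hA : A.card ≤ d) : (rowSupport U A).card ≤ d := by
  rcases (rowSupport U A).eq_empty_or_nonempty with h0 | ⟨i₀, hi₀⟩
  · simp [h0]
  let p : Submodule ℝ (Fin N → ℝ) :=
    { carrier := {v | ∀ j ∉ A, v j = 0}
      add_mem' := fun {a b} ha hb j hj => by simp [ha j hj, hb j hj]
      zero_mem' := fun j _ => rfl
      smul_mem' := fun c a ha j hj => by simp [ha j hj] }
  let f : rowSupport U A → Module.Dual ℝ (Fin N → ℝ) := fun i =>
    (LinearMap.proj i.1).comp U.mulVecLin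
  obtain ⟨x, hxp, hx⟩ := Module.Dual.exists_forall_mem_ne_zero_of_forall_exists p f fun i => by
    obtain ⟨j, hj, hij⟩ := mem_rowSupport.1 i.2
    refine ⟨Pi.single j 1, fun k hk => ?_, ?_⟩
    · rw [Pi.single_eq_of_ne]
      rintro rfl
      exact hk hj
    · simpa [f] using hij
  have hx0 : WithLp.toLp 2 x ≠ 0 := fun h => hx ⟨i₀, hi₀⟩ (by
    rw [show x = 0 from congrArg WithLp.ofLp h, map_zero])
  let y : EuclideanSpace ℝ (Fin N) := ‖WithLp.toLp 2 x‖⁻¹ • WithLp.toLp 2 x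
  have hn : ‖WithLp.toLp 2 x‖⁻¹ ≠ 0 := inv_ne_zero (norm_ne_zero_iff.2 hx0)
  have hy : y ∈ polygonalSphere N d := by
    refine mem_polygonalSphere_iff.2 ⟨norm_smul_inv_norm (𝕜 := ℝ) hx0, le_trans ?_ hA⟩
    refine Finset.card_le_card fun j hj => ?_
    by_contra hjA
    refine (Finset.mem_filter.1 hj).2 ?_
    simp [y, show x j = 0 from hxp j hjA]
  refine le_trans (Finset.card_le_card fun i hi => ?_) (mem_polygonalSphere_iff.1 (hU y hy)).2
  refine Finset.mem_filter.2 ⟨Finset.mem_univ _, ?_⟩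
  have : U.mulVec y.ofLp i = ‖WithLp.toLp 2 x‖⁻¹ * f ⟨i, hi⟩ x := by
    simp [y, f, Matrix.mulVec_smul]
  exact ne_of_eq_of_ne this (mul_ne_zero hn (hx ⟨i, hi⟩))

/-- If an orthogonal matrix preserves the polygonal sphere then a set of `d` columns has no nonzero
row in common with the complementary columns. -/
theorem eq_zero_of_mem_rowSupport {U : Matrix (Fin N) (Fin N) ℝ} (hO : U ∈ orthogonalMatrices N)
    (hU : ∀ x ∈ polygonalSphere N d, WithLp.toLp 2 (U.mulVec x) ∈ polygonalSphere N d)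
    {A : Finset (Fin N)} (hA : A.card = d) {i k : Fin N} (hi : i ∈ rowSupport U A) (hk : k ∉ A) :
    U i k = 0 := by
  -- Squared entries are counted in two ways. The `d` unit columns in `A` live in the rows of
  -- `rowSupport U A` and contribute exactly `d`. These rows are unit vectors and at most `d` in
  -- number, so nothing is left outside `A`.
  have h1 : ∑ j ∈ A, ∑ i ∈ rowSupport U A, U i j * U i j = d := by
    rw [← hA, Finset.card_eq_sum_ones, Nat.cast_sum]
    refine Finset.sum_congr rfl fun j hj => ?_
    have := sum_col_of_mem_orthogonalMatrices hO j j
    rw [if_pos rfl] at this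
    rw [Nat.cast_one, ← this]
    refine Finset.sum_subset (Finset.subset_univ _) fun i _ hi => ?_
    have : U i j = 0 := by
      by_contra hne
      exact hi (mem_rowSupport.2 ⟨j, hj, hne⟩)
    rw [this, zero_mul]
  have h2 : ∑ i ∈ rowSupport U A, ∑ j, U i j * U i j = (rowSupport U A).card := by
    rw [Finset.card_eq_sum_ones, Nat.cast_sum]
    refine Finset.sum_congr rfl fun j hj => ?_
    rw [sum_row_of_mem_orthogonalMatrices hO, if_pos rfl, Nat.cast_one]
  have h3 : ∑ i ∈ rowSupport U A, ∑ j ∈ Aᶜ, U i j * U i j ≤ 0 := by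
    have h4 : ((rowSupport U A).card : ℝ) ≤ d := by exact_mod_cast card_rowSupport_le hU hA.le
    rw [Finset.sum_comm] at h1
    simp only [← Finset.sum_add_sum_compl A (fun j => U _ j * U _ j), Finset.sum_add_distrib]
      at h2
    linarith
  have h5 : ∀ i ∈ rowSupport U A, 0 ≤ ∑ j ∈ Aᶜ, U i j * U i j := fun i _ =>
    Finset.sum_nonneg fun j _ => mul_self_nonneg _
  have h6 := (Finset.sum_eq_zero_iff_of_nonneg h5).1 (le_antisymm h3 (Finset.sum_nonneg h5)) i hi
  exact mul_self_eq_zero.1 ((Finset.sum_eq_zero_iff_of_nonneg fun j _ => mul_self_nonneg _).1 h6 k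
    (Finset.mem_compl.2 hk))

/-- For `1 ≤ d < N`, an orthogonal matrix preserving the polygonal sphere is a signed
permutation. -/
theorem mem_signedPermutations_of_preserves (hd : 1 ≤ d) (hdN : d < N)
    {U : Matrix (Fin N) (Fin N) ℝ} (hO : U ∈ orthogonalMatrices N)
    (hU : ∀ x ∈ polygonalSphere N d, WithLp.toLp 2 (U.mulVec x) ∈ polygonalSphere N d) :
    U ∈ signedPermutations N := by
  refine mem_signedPermutations hO fun i j k hjk => ?_
  -- A set of `d` columns containing j but not k exists because 1 ≤ d ≤ N - 1.
  obtain ⟨A, hjA, hAk, hA⟩ := Finset.exists_subsuperset_card_eq (s := {j})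
    (t := Finset.univ.erase k) (n := d) (by simpa using hjk) (by simpa using hd)
    (by rw [Finset.card_erase_of_mem (Finset.mem_univ k), Finset.card_univ, Fintype.card_fin]
        omega)
  by_cases h : U i j = 0
  · rw [h, zero_mul]
  · rw [eq_zero_of_mem_rowSupport hO hU hA (i := i) (k := k) (mem_rowSupport.2
      ⟨j, hjA (Finset.mem_singleton_self j), h⟩)
      fun hk => (Finset.mem_erase.1 (hAk hk)).1 rfl, mul_zero]

end Sphere

end

section

variable {N d : ℕ}

/-! ### Relations forced by an affine action -/

namespace CoordAlgebra

variable {H : CoordAlgebra.{u} N}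

theorem IsQuantumSubgroup.sum_row (hH : H.IsQuantumSubgroup) (i j : Fin N) :
    ∑ k, H.u i k * H.u j k = if i = j then 1 else 0 :=
  (congrFun (congrFun hH.mul_transpose i) j).trans Matrix.one_apply

theorem IsQuantumSubgroup.sum_col (hH : H.IsQuantumSubgroup) (i j : Fin N) :
    ∑ k, H.u k i * H.u k j = if i = j then 1 else 0 :=
  (congrFun (congrFun hH.transpose_mul i) j).trans Matrix.one_apply

/-- The coinverse exchanges the coordinates with those of the transpose. -/
theorem IsQuantumSubgroup.exists_transpose (hH : H.IsQuantumSubgroup) :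
    ∃ κ : H.poly →ₗ[ℂ] H.poly, (∀ a b, κ (a * b) = κ b * κ a) ∧
      ∀ i j, κ (H.polyU i j) = H.polyU j i := by
  obtain ⟨κ, hmul, -, hκ, -⟩ := hH.coinverse
  refine ⟨κ, hmul, fun i l => ?_⟩
  have hrow : ∀ k, ∑ j, H.polyU k j * H.polyU l j = if k = l then 1 else 0 := fun k => by
    refine Subtype.ext ?_
    simp only [polyU, AddSubmonoidClass.coe_finsetSum, MulMemClass.mk_mul_mk, hH.sum_row]
    split_ifs <;> rfl
  -- κ(u) is a left inverse of u and the transpose is a right inverse, so they coincide.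
  calc κ (H.polyU i l) = ∑ k, κ (H.polyU i k) * ∑ j, H.polyU k j * H.polyU l j := by
        simp [hrow]
    _ = ∑ j, (∑ k, κ (H.polyU i k) * H.polyU k j) * H.polyU l j := by
        simp only [Finset.mul_sum, Finset.sum_mul, mul_assoc]
        exact Finset.sum_comm
    _ = H.polyU l i := by simp [hκ]

/-- Evaluating an affine action at a point. -/
theorem ActsAffinely.exists_eval {X : Set (EuclideanSpace ℝ (Fin N))} [CompactSpace X]
    (h : H.ActsAffinely X) (p : X) : ∃ φ : C(X, ℂ) →⋆ₐ[ℂ] H.A,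
      ∀ i, φ (coordFun X i) = ∑ j, (p.1 j : ℂ) • H.u i j := by
  obtain ⟨Φ, hΦ⟩ := h
  let ev : C(X, H.A) →⋆ₐ[ℂ] H.A :=
    { toFun := fun f => f p
      map_one' := rfl
      map_mul' := fun _ _ => rfl
      map_zero' := rfl
      map_add' := fun _ _ => rfl
      commutes' := fun _ => rfl
      map_star' := fun _ => rfl }
  refine ⟨ev.comp Φ, fun i => ?_⟩
  change (Φ (coordFun X i)) p = _
  rw [hΦ]
  exact ContinuousMap.sum_apply _ _ p

/-- The coordinates of a quantum group acting affinely on `S^{N-1,d-1}`, `d ≥ 2`, commute. -/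
theorem IsQuantumSubgroup.u_comm (hH : H.IsQuantumSubgroup) (hd : 2 ≤ d)
    (hA : H.ActsAffinely (polygonalSphere N d)) (i j k l : Fin N) :
    H.u i j * H.u k l = H.u k l * H.u i j := by
  have hsame : ∀ i j k, H.u i j * H.u k j = H.u k j * H.u i j := fun i j k => by
    obtain ⟨φ, hφ⟩ := hA.exists_eval
      ⟨_, single_mem_polygonalSphere (one_le_two.trans hd) j (ε := 1) (by simp)⟩
    have h : ∀ i, φ (coordFun _ i) = H.u i j := fun i => by
      rw [hφ, Finset.sum_eq_single j (fun l _ hl => by simp [hl]) (by simp)]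
      simp
    rw [← h i, ← h k, ← map_mul, mul_comm, map_mul]
  have hpair : ∀ i j k l, H.u i j * H.u k l + H.u i l * H.u k j =
      H.u k l * H.u i j + H.u k j * H.u i l := fun i j k l => by
    rcases eq_or_ne j l with rfl | hjl
    · rw [hsame]
    obtain ⟨φ, hφ⟩ := hA.exists_eval ⟨_, add_single_mem_polygonalSphere hd hjl⟩
    have h : ∀ i, φ (coordFun _ i) = (3 / 5 : ℂ) • H.u i j + (4 / 5 : ℂ) • H.u i l := fun i => by
      rw [hφ, Finset.sum_eq_add j l hjl (fun m _ hm => by simp [hm.1, hm.2]) (by simp) (by simp)]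
      simp [hjl, hjl.symm]
    have hc : φ (coordFun _ i) * φ (coordFun _ k) = φ (coordFun _ k) * φ (coordFun _ i) := by
      rw [← map_mul, mul_comm, map_mul]
    simp only [h, add_mul, mul_add, smul_mul_smul_comm, hsame k j i, hsame k l i] at hc
    -- Products within one column cancel by `hsame`; the cross terms carry 3/5 · 4/5 = 12/25.
    have h2 : (12 / 25 : ℂ) • (H.u i j * H.u k l + H.u i l * H.u k j) =
        (12 / 25 : ℂ) • (H.u k l * H.u i j + H.u k j * H.u i l) := by
      rw [← sub_eq_zero] at hc ⊢
      rw [← hc]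
      module
    exact smul_right_injective H.A (by norm_num : (12 / 25 : ℂ) ≠ 0) h2
  obtain ⟨κ, hmul, hκ⟩ := hH.exists_transpose
  have h1 := hpair i j k l
  -- The coinverse applied to `hpair l k j i`. Compared with `h1`, the commutator of u_il and u_kj
  -- has the opposite sign, so adding the two relations removes it.
  have h2 : H.u i j * H.u k l + H.u k j * H.u i l = H.u k l * H.u i j + H.u i l * H.u k j := by
    have h : H.polyU l k * H.polyU j i + H.polyU l i * H.polyU j k =
        H.polyU j i * H.polyU l k + H.polyU j k * H.polyU l i := Subtype.ext (hpair l k j i)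
    have := congrArg κ h
    simp only [map_add, hmul, hκ] at this
    exact congrArg Subtype.val this
  have h3 : (2 : ℂ) • (H.u i j * H.u k l) = (2 : ℂ) • (H.u k l * H.u i j) := by
    rw [← sub_eq_zero] at h1 h2 ⊢
    rw [← add_zero (0 : H.A)]
    nth_rw 1 [← h1]
    rw [← h2]
    module
  exact smul_right_injective H.A (two_ne_zero (α := ℂ)) h3

/-- The self-adjoint commuting coordinates generate a commutative ⋆-algebra; density extends this
one variable at a time. -/
theorem IsQuantumSubgroup.mul_comm_of_u_comm (hH : H.IsQuantumSubgroup)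
    (h : ∀ i j k l, H.u i j * H.u k l = H.u k l * H.u i j) (a b : H.A) : a * b = b * a := by
  have hp : IsMulCommutative H.poly := StarAlgebra.isMulCommutative_adjoin ℂ
    (by rintro _ ⟨i, j, rfl⟩ _ ⟨k, l, rfl⟩; exact h i j k l)
    (by rintro _ ⟨i, j, rfl⟩ _ ⟨k, l, rfl⟩; rw [hH.selfAdjoint]; exact h i j k l)
  have hpoly : ∀ a ∈ H.poly, ∀ b ∈ H.poly, a * b = b * a := fun a ha b hb =>
    congrArg Subtype.val (hp.is_comm.comm (⟨a, ha⟩ : H.poly) ⟨b, hb⟩)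
  refine hH.dense.induction (P := fun b => a * b = b * a) (fun b hb => ?_)
    (isClosed_eq (by fun_prop) (by fun_prop)) b
  exact hH.dense.induction (P := fun a => a * b = b * a) (fun a ha => hpoly a ha b hb)
    (isClosed_eq (by fun_prop) (by fun_prop)) a

/-- A quantum group with commuting coordinates acting affinely on `X` is a subgroup of every compact
set of matrices containing all orthogonal matrices preserving `X`. -/
theorem IsQuantumSubgroup.isSubgroupOf_ofMatrices (hH : H.IsQuantumSubgroup)
    (h : ∀ i j k l, H.u i j * H.u k l = H.u k l * H.u i j)
    {X : Set (EuclideanSpace ℝ (Fin N))} [CompactSpace X] (hA : H.ActsAffinely X)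
    (S : Set (Matrix (Fin N) (Fin N) ℝ)) [CompactSpace S]
    (hS : ∀ U ∈ orthogonalMatrices N, (∀ x ∈ X, WithLp.toLp 2 (U.mulVec x) ∈ X) → U ∈ S) :
    H.IsSubgroupOf (ofMatrices S) := by
  refine exists_lift_ofMatrices (hH.mul_comm_of_u_comm h) S H.u fun χ => ?_
  choose U hU using fun i j => exists_real_of_character χ (hH.selfAdjoint i j)
  refine ⟨Matrix.of U, hS _ ?_ fun x hx => ?_, hU⟩
  · refine (Matrix.mem_orthogonalGroup_iff _ _).2 ?_
    ext i j
    have := congrArg χ (hH.sum_row i j)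
    rw [map_sum] at this
    simp only [map_mul, hU] at this
    rw [Matrix.one_apply]
    refine Complex.ofReal_injective ?_
    simp only [Matrix.mul_apply, Matrix.transpose_apply, Matrix.of_apply,
      Complex.ofReal_sum, Complex.ofReal_mul]
    refine this.trans ?_
    split_ifs <;> simp
  -- The character χ ∘ φ_x of C(X) is evaluation at some y in `X`, and comparing coordinates gives
  -- Ux = y.
  · obtain ⟨φ, hφ⟩ := hA.exists_eval ⟨x, hx⟩
    obtain ⟨y, hy⟩ := exists_eq_eval (χ.comp φ.toAlgHom)
    have e : WithLp.toLp 2 ((Matrix.of U).mulVec x) = y.1 := by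
      ext i
      refine Complex.ofReal_injective ?_
      refine Eq.trans ?_ (hy (coordFun X i))
      refine Eq.trans ?_ (congrArg χ (hφ i)).symm
      simp only [Matrix.mulVec, dotProduct, Matrix.of_apply, Complex.ofReal_sum,
        Complex.ofReal_mul, map_sum, map_smul, hU, smul_eq_mul, mul_comm]
    exact e ▸ y.2

/-- The coordinates of a quantum group acting affinely on `S^{N-1,0}` satisfy the relations of the
free hyperoctahedral group. -/
theorem IsQuantumSubgroup.isCubic (hH : H.IsQuantumSubgroup)
    (hA : H.ActsAffinely (polygonalSphere N 1)) : IsCubic H.u := by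
  have hcol : ∀ i j k, j ≠ k → H.u j i * H.u k i = 0 := fun i j k hjk => by
    obtain ⟨φ, hφ⟩ := hA.exists_eval
      ⟨_, single_mem_polygonalSphere le_rfl i (ε := 1) (by simp)⟩
    have h : ∀ j, φ (coordFun _ j) = H.u j i := fun j => by
      rw [hφ, Finset.sum_eq_single i (fun l _ hl => by simp [hl]) (by simp)]
      simp
    rw [← h j, ← h k, ← map_mul]
    -- Every point of this sphere has only one nonzero coordinate.
    have : coordFun (polygonalSphere N 1) j * coordFun (polygonalSphere N 1) k = 0 := by
      ext x
      obtain ⟨l, ε, hx⟩ := exists_eq_single_of_mem x.2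
      change (x.1 j : ℂ) * (x.1 k : ℂ) = 0
      rw [hx]
      rcases eq_or_ne j l with rfl | hjl
      · simp [hjk.symm]
      · simp [hjl]
    rw [this, map_zero]
  refine ⟨hH.selfAdjoint, hH.sum_row, hH.sum_col, fun i j k hjk => ?_, hcol⟩
  obtain ⟨κ, hmul, hκ⟩ := hH.exists_transpose
  have h : H.polyU k i * H.polyU j i = 0 := Subtype.ext (hcol i k j hjk.symm)
  have := congrArg κ h
  rw [hmul, hκ, hκ, map_zero] at this
  exact congrArg Subtype.val this

end CoordAlgebra

/-! ### The action of the free hyperoctahedral group on the vertices -/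

section Action

variable {A : Type u} [CStarAlgebra A] {X : Type v} [TopologicalSpace X]

/-- The ⋆-homomorphism out of `C(X)` determined by finitely many points and a partition of unity
into orthogonal projections. -/
def projectionHom {ι : Type*} [Fintype ι] [DecidableEq ι] (x : ι → X) (e : ι → A)
    (hstar : ∀ a, star (e a) = e a) (hmul : ∀ a b, e a * e b = if a = b then e a else 0)
    (hsum : ∑ a, e a = 1) : C(X, ℂ) →⋆ₐ[ℂ] A where
  toFun f := ∑ a, f (x a) • e a
  map_one' := by simpa using hsum
  map_mul' f g := by
    simp only [Finset.sum_mul_sum, smul_mul_smul_comm, hmul, smul_ite, smul_zero,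
      Finset.sum_ite_eq, Finset.mem_univ, if_true, ContinuousMap.mul_apply]
  map_zero' := by simp
  map_add' f g := by simp [add_smul, Finset.sum_add_distrib]
  commutes' c := by
    change ∑ a, c • e a = _
    rw [← Finset.smul_sum, hsum, Algebra.algebraMap_eq_smul_one]
  map_star' f := by simp [star_sum, star_smul, hstar]

/-- The spectral projections of a family `w` of self-adjoint elements with orthogonal supports and
with `∑ w_i² = 1`. -/
def spectralProjection (w : Fin N → A) (a : Fin N × ℤˣ) : A :=
  (1 / 2 : ℂ) • (w a.1 * w a.1 + ((a.2 : ℤ) : ℂ) • w a.1)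

theorem star_spectralProjection {w : Fin N → A} (hstar : ∀ i, star (w i) = w i)
    (a : Fin N × ℤˣ) : star (spectralProjection w a) = spectralProjection w a := by
  simp [spectralProjection, hstar]

/-- Multiplying ∑ w_k² = 1 by w_i gives w_i³ = w_i, so (w_i² ± w_i)/2 are the spectral projections
of w_i at ±1; for distinct indices they are orthogonal because w_i w_k = 0. -/
theorem spectralProjection_mul {w : Fin N → A} (hmul : ∀ i k, i ≠ k → w i * w k = 0)
    (hsum : ∑ i, w i * w i = 1) (a b : Fin N × ℤˣ) :
    spectralProjection w a * spectralProjection w b =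
      if a = b then spectralProjection w a else 0 := by
  obtain ⟨i, ε⟩ := a
  obtain ⟨k, δ⟩ := b
  rcases eq_or_ne i k with rfl | hik
  · have h3 : w i * (w i * w i) = w i := by
      have := congrArg (w i * ·) hsum
      simp only [Finset.mul_sum, mul_one] at this
      rwa [Finset.sum_eq_single i
        (fun k _ hk => by rw [← mul_assoc, hmul i k hk.symm, zero_mul]) (by simp)] at this
    have h3' : w i * w i * w i = w i := by rw [mul_assoc, h3]
    have h4 : w i * w i * (w i * w i) = w i * w i := by rw [mul_assoc, h3]
    simp only [spectralProjection, add_mul, mul_add, mul_smul_comm,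
      smul_mul_assoc, h3, h3', h4, Prod.mk.injEq, true_and]
    rcases Int.units_eq_one_or ε with rfl | rfl <;> rcases Int.units_eq_one_or δ with rfl | rfl
    · simp only [if_true, Units.val_one, Int.cast_one]
      module
    · rw [if_neg (by decide)]
      simp only [Units.val_one, Int.cast_one, Units.val_neg, Int.cast_neg]
      module
    · rw [if_neg (by decide)]
      simp only [Units.val_one, Int.cast_one, Units.val_neg, Int.cast_neg]
      module
    · simp only [if_true, Units.val_one, Int.cast_one, Units.val_neg, Int.cast_neg]
      module
  · rw [if_neg (by simp [hik])]
    have h3 : w i * (w k * w k) = 0 := by rw [← mul_assoc, hmul i k hik, zero_mul]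
    have h3' : w i * w i * w k = 0 := by rw [mul_assoc, hmul i k hik, mul_zero]
    have h4 : w i * w i * (w k * w k) = 0 := by rw [mul_assoc, h3, mul_zero]
    simp only [spectralProjection, add_mul, mul_add, mul_smul_comm,
      smul_mul_assoc, h3, h3', h4, hmul i k hik, smul_zero, add_zero]

theorem sum_spectralProjection {w : Fin N → A} (hsum : ∑ i, w i * w i = 1) :
    ∑ a, spectralProjection w a = 1 := by
  rw [Fintype.sum_prod_type, ← hsum]
  refine Finset.sum_congr rfl fun i _ => ?_
  rw [UnitsInt.univ, Finset.sum_pair (by decide)]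
  simp only [spectralProjection, Units.val_one, Int.cast_one, Units.val_neg, Int.cast_neg]
  module

/-- The points of `S^{N-1,0}`. -/
def vertex (a : Fin N × ℤˣ) : polygonalSphere N 1 :=
  ⟨EuclideanSpace.single a.1 ((a.2 : ℤ) : ℝ), single_mem_polygonalSphere le_rfl _ (by
    rcases Int.units_eq_one_or a.2 with h | h <;> simp [h])⟩

/-- The difference of the projections at 1 and -1 recovers w_i, so `projectionHom` sends x_i to w_i.
-/
theorem sum_coordFun_vertex (w : Fin N → A) (i : Fin N) :
    ∑ a, coordFun (polygonalSphere N 1) i (vertex a) • spectralProjection w a = w i := by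
  have h : ∀ a, coordFun (polygonalSphere N 1) i (vertex a) =
      if i = a.1 then ((a.2 : ℤ) : ℂ) else 0 := fun a => by
    change (((EuclideanSpace.single a.1 ((a.2 : ℤ) : ℝ) : EuclideanSpace ℝ (Fin N)) i : ℝ) : ℂ) = _
    rw [PiLp.single_apply]
    split_ifs <;> simp
  simp only [h]
  rw [Fintype.sum_prod_type, Finset.sum_eq_single i (fun k _ hk => by simp [hk.symm]) (by simp),
    UnitsInt.univ, Finset.sum_pair (by decide)]
  simp only [spectralProjection, Units.val_one, Int.cast_one, Units.val_neg, Int.cast_neg, if_true]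
  module

/-- At each point p = ±e_j, the family w_i = ±u_ij has orthogonal spectral projections summing to 1,
which define φ_p; these homomorphisms are then assembled over p. -/
theorem IsCubic.actsAffinely {G : CoordAlgebra.{u} N} (hG : IsCubic G.u) :
    G.ActsAffinely (polygonalSphere N 1) := by
  let w : polygonalSphere N 1 → Fin N → G.A := fun p i => ∑ j, (p.1 j : ℂ) • G.u i j
  have hw : ∀ p, ∃ (j : Fin N) (ε : ℤˣ), ∀ i, w p i = ((ε : ℤ) : ℂ) • G.u i j := fun p => by
    obtain ⟨j, ε, h⟩ := exists_eq_single_of_mem p.2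
    refine ⟨j, ε, fun i => ?_⟩
    simp only [w, h]
    rw [Finset.sum_eq_single j (fun l _ hl => by simp [hl]) (by simp)]
    simp
  have hstar : ∀ p i, star (w p i) = w p i := fun p i => by
    simp [w, star_sum, star_smul, hG.star_eq]
  have hmul : ∀ p i k, i ≠ k → w p i * w p k = 0 := fun p i k hik => by
    obtain ⟨j, ε, h⟩ := hw p
    rw [h, h, smul_mul_smul_comm, hG.mul_col j i k hik, smul_zero]
  have hsum : ∀ p, ∑ i, w p i * w p i = 1 := fun p => by
    obtain ⟨j, ε, h⟩ := hw p
    simp only [h, smul_mul_smul_comm, ← Finset.smul_sum, hG.sum_col, if_true]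
    rcases Int.units_eq_one_or ε with rfl | rfl <;> simp
  let φ : polygonalSphere N 1 → C(polygonalSphere N 1, ℂ) →⋆ₐ[ℂ] G.A := fun p =>
    projectionHom vertex (spectralProjection (w p)) (star_spectralProjection (hstar p))
      (spectralProjection_mul (hmul p) (hsum p)) (sum_spectralProjection (hsum p))
  have hφ : ∀ p f, φ p f = ∑ a, f (vertex a) • spectralProjection (w p) a := fun _ _ => rfl
  -- The projections are polynomial in the coordinates of p.
  have hcont : ∀ f, Continuous fun p => φ p f := fun f => by
    simp only [hφ, spectralProjection, w]
    fun_prop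
  let Φ : C(polygonalSphere N 1, ℂ) →⋆ₐ[ℂ] C(polygonalSphere N 1, G.A) :=
    { toFun := fun f => ⟨fun p => φ p f, hcont f⟩
      map_one' := ContinuousMap.ext fun p => map_one (φ p)
      map_mul' := fun f g => ContinuousMap.ext fun p => map_mul (φ p) f g
      map_zero' := ContinuousMap.ext fun p => map_zero (φ p)
      map_add' := fun f g => ContinuousMap.ext fun p => map_add (φ p) f g
      commutes' := fun c => ContinuousMap.ext fun p => AlgHomClass.commutes (φ p) c
      map_star' := fun f => ContinuousMap.ext fun p => map_star (φ p) f }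
  refine ⟨Φ, fun i => ContinuousMap.ext fun p => ?_⟩
  refine ((hφ p _).trans (sum_coordFun_vertex (w p) i)).trans ?_
  exact (ContinuousMap.sum_apply Finset.univ (fun j => funTensor (G.u i j) (coordFun _ j)) p).symm

end Action

/-! ### The three quantum isometry groups -/

section Main

theorem isQuantumSubgroup_orthogonalGroup (N : ℕ) : (orthogonalGroup N).IsQuantumSubgroup :=
  isQuantumSubgroup_ofMatrices _ ⟨1, one_mem_orthogonalMatrices⟩ subset_rfl
    (fun _ hU _ hV => mul_mem_orthogonalMatrices hU hV)
    fun _ hU => transpose_mem_orthogonalMatrices hU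

theorem isQuantumSubgroup_hyperoctahedralGroup (N : ℕ) :
    (hyperoctahedralGroup N).IsQuantumSubgroup :=
  isQuantumSubgroup_ofMatrices _ ⟨1, one_mem_signedPermutations⟩ signedPermutations_subset
    (fun _ hU _ hV => mul_mem_signedPermutations hU hV)
    fun _ hU => transpose_mem_signedPermutations hU

theorem isQuantumIsometryGroup_freeHyperoctahedralGroup (N : ℕ) :
    IsQuantumIsometryGroup.{u} (polygonalSphere N 1) (freeHyperoctahedralGroup N) where
  isQuantumSubgroup := isQuantumSubgroup_freeHyperoctahedralGroup N
  actsAffinely := (isCubic_freeHyperoctahedralGroup N).actsAffinely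
  universal _ hH hA := (hH.isCubic hA).exists_lift

theorem isQuantumIsometryGroup_hyperoctahedralGroup (hd : 2 ≤ d) (hdN : d < N) :
    IsQuantumIsometryGroup.{u} (polygonalSphere N d) (hyperoctahedralGroup N) where
  isQuantumSubgroup := isQuantumSubgroup_hyperoctahedralGroup N
  actsAffinely := actsAffinely_ofMatrices _ _ fun _ hU _ hx => mulVec_mem_polygonalSphere hU hx
  universal _ hH hA := hH.isSubgroupOf_ofMatrices (hH.u_comm hd hA) hA _ fun _ hO hU =>
    mem_signedPermutations_of_preserves (one_le_two.trans hd) hdN hO hU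

theorem isQuantumIsometryGroup_orthogonalGroup (hN : 1 ≤ N) :
    IsQuantumIsometryGroup.{u} (polygonalSphere N N) (orthogonalGroup N) where
  isQuantumSubgroup := isQuantumSubgroup_orthogonalGroup N
  actsAffinely := actsAffinely_ofMatrices _ _ fun _ hU _ hx => mulVec_mem_polygonalSphere_self hU hx
  universal _ hH hA := hH.isSubgroupOf_ofMatrices (fun i j k l => by
    -- For N = 1 there is a single coordinate, which commutes with itself; otherwise d = N ≥ 2 and
    -- `u_comm` applies.
    rcases hN.eq_or_lt with rfl | h
    · rw [Subsingleton.elim k i, Subsingleton.elim l j]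
    · exact hH.u_comm h hA i j k l) hA _ fun _ hO _ => hO

end Main

end

end PolygonalSphere

end

theorem proposition3p3 (N d : ℕ) (hd : 1 ≤ d) (hdN : d ≤ N) :
    (d = 1 → PolygonalSphere.CoordAlgebra.IsQuantumIsometryGroup.{u}
      (PolygonalSphere.polygonalSphere N d) (PolygonalSphere.freeHyperoctahedralGroup N)) ∧
    (2 ≤ d ∧ d < N → PolygonalSphere.CoordAlgebra.IsQuantumIsometryGroup.{u}
      (PolygonalSphere.polygonalSphere N d) (PolygonalSphere.hyperoctahedralGroup N)) ∧
    (d = N → PolygonalSphere.CoordAlgebra.IsQuantumIsometryGroup.{u}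
      (PolygonalSphere.polygonalSphere N d) (PolygonalSphere.orthogonalGroup N)) := by
  refine ⟨?_, fun h => ?_, ?_⟩
  · rintro rfl
    exact PolygonalSphere.isQuantumIsometryGroup_freeHyperoctahedralGroup N
  · exact PolygonalSphere.isQuantumIsometryGroup_hyperoctahedralGroup h.1 h.2
  · rintro rfl
    exact PolygonalSphere.isQuantumIsometryGroup_orthogonalGroup hd
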